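/- Let $\Bbbk$ be an algebraically closed field of characteristic zero, let $\xi\in\Bbbk$ be a primitive $4$-th root of unity and fix $\sqrt2\in\Bbbk$, a square root of $2$. Let $\mathcal K$ be the Hopf algebra generated as an algebra by $a,b,c,d$ with relations $$ab=\xi ba,\quad ac=\xi ca,\quad cb=bc=0,\quad cd=\xi dc,\quad bd=\xi db,\quad ad=da=1,\quad b^2=c^2=0,\quad a^2c=b,\quad a^4=1,$$ with coalgebra structure and antipode determined by $$\Delta(a)=a\otimes a+b\otimes c,\quad \Delta(b)=a\otimes b+b\otimes d,\quad \Delta(c)=c\otimes a+d\otimes c,\quad \Delta(d)=c\otimes b+d\otimes d,$$ $$\varepsilon(a)=\varepsilon(d)=1,\quad \varepsilon(b)=\varepsilon(c)=0,\quad S(a)=d,\quad S(b)=\xi b,\quad S(c)=-\xi c,\quad S(d)=a.$$ Let $\mathcal K^{\mathrm{cop}}$ be the co-opposite Hopf algebra (flipped comultiplication, antipode $S^{-1}$). For a Hopf algebra $H$ with bijective antipode, the Drinfeld double $D(H)$ is, as an algebra, the vector space $H^*\otimes H$, whose element $f\otimes h$ is written $f\bowtie h$, with unit $\varepsilon\bowtie1$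 and product $$(f\bowtie h)(g\bowtie k)=\sum f\cdot g\big(S_H^{-1}(h_{(3)})\,?\,h_{(1)}\big)\bowtie h_{(2)}k ,$$ where $g(S_H^{-1}(q)\,?\,p)$ denotes the functional $u\mapsto g(S_H^{-1}(q)up)$ and $f\cdot f'$ is the convolution product of $H^*$. Let $D=D(\mathcal K^{\mathrm{cop}})$ and write $u$ for $\varepsilon\bowtie u$ ($u\in\mathcal K$). Let $g=\alpha_1\bowtie 1\in D$, where $\alpha_1:\mathcal K\to\Bbbk$ is the algebra map with $\alpha_1(a)=\xi^{-1}$, $\alpha_1(b)=\alpha_1(c)=0$, $\alpha_1(d)=\xi$. Let $x=\theta\bowtie1\in D$, where $\theta$ is the linear functional on $\mathcal K$ with value $\sqrt2\,\xi$ on $b,c,ab,ac$ and value $0$ on $1,a,d,a^2$ (these eight elements form a basis of $\mathcal K$). Put $\Lambda=\{(i,j)\in\mathbb Z_4\times\mathbb Z_4:\ 2i\neq j\}$. Theorem. $\dim_\Bbbk D=64$, and the following hold. (1) For each $j\in\mathbb Z_4$ there is a unique algebra map $\chi^j:D\to\Bbbk$ with $$\chi^j(a)=\xi^j,\quad \chi^j(b)=\chi^j(c)=\chi^j(x)=0,\quad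 \chi^j(d)=\xi^{-j},\quad \chi^j(g)=(-1)^j .$$ Let $\Bbbk_{\chi^j}$ be the corresponding $1$-dimensional left $D$-module. (2) For each $(i,j)\in\Lambda$ there is a unique algebra map $\rho_{i,j}:D\to M_2(\Bbbk)$ with $$\rho_{i,j}(a)=\begin{pmatrix}\xi^i&0\\0&\xi^{i+3}\end{pmatrix},\quad \rho_{i,j}(b)=\begin{pmatrix}0&(-1)^i\\0&0\end{pmatrix},\quad \rho_{i,j}(c)=\begin{pmatrix}0&1\\0&0\end{pmatrix},\quad \rho_{i,j}(d)=\begin{pmatrix}\xi^{-i}&0\\0&\xi^{-i+1}\end{pmatrix},$$ $$\rho_{i,j}(g)=\begin{pmatrix}\xi^j&0\\0&\xi^{j+2}\end{pmatrix},\quad \rho_{i,j}(x)=\begin{pmatrix}0&\tfrac{\sqrt2}{2}\xi(\xi^i+\xi^{3i+j})\\ \sqrt2\,\xi(\xi^{3i}-\xi^{i+j})&0\end{pmatrix}.$$ Let $V_{i,j}=\Bbbk^2$ be the corresponding $2$-dimensional left $D$-module. (3) The four modules $\Bbbk_{\chi^j}$ ($j\in\mathbb Z_4$) and the twelve modules $V_{i,j}$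 ($(i,j)\in\Lambda$) are simple and pairwise non-isomorphic, and every simple left $D$-module is isomorphic to one of them. In particular $D$ has exactly sixteen simple left modules up to isomorphism. -/

import Mathlib

universe u v

open scoped TensorProduct
open WithConv

noncomputable section

/-- A Hopf algebra whose antipode is bijective. -/
class HasBijectiveAntipode (𝕜 : Type*) (H : Type*) [Field 𝕜] [Ring H] [HopfAlgebra 𝕜 H] :
    Prop where
  bijective : Function.Bijective (HopfAlgebra.antipode 𝕜 (A := H))

section InvAntipode

variable (𝕜 : Type*) (H : Type*) [Field 𝕜] [Ring H] [HopfAlgebra 𝕜 H]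

open Coalgebra HopfAlgebra

theorem antipode_comul_left_inv :
    toConv (TensorProduct.map (antipode 𝕜) (antipode 𝕜) ∘ₗ
        (TensorProduct.comm 𝕜 H H).toLinearMap ∘ₗ comul) * toConv (comul (R := 𝕜) (A := H)) = 1 := by
  let W : (H ⊗[𝕜] H) ⊗[𝕜] (H ⊗[𝕜] H) →ₗ[𝕜] H ⊗[𝕜] H :=
    LinearMap.mul' 𝕜 (H ⊗[𝕜] H) ∘ₗ TensorProduct.map (TensorProduct.map (antipode 𝕜) (antipode 𝕜) ∘ₗ
        (TensorProduct.comm 𝕜 H H).toLinearMap) .id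
  let Q : H ⊗[𝕜] ((H ⊗[𝕜] H) ⊗[𝕜] H) →ₗ[𝕜] (H ⊗[𝕜] H) ⊗[𝕜] (H ⊗[𝕜] H) :=
    (TensorProduct.assoc 𝕜 H H (H ⊗[𝕜] H)).symm.toLinearMap ∘ₗ
      TensorProduct.map .id (TensorProduct.assoc 𝕜 H H H).toLinearMap
  have h1 : TensorProduct.map (comul (R := 𝕜) (A := H)) comul ∘ₗ comul =
      Q ∘ₗ TensorProduct.map .id (TensorProduct.map comul .id ∘ₗ comul) ∘ₗ comul := by
    simp only [Q, coassoc_simps]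
  have h2 : ∀ x y z : H, W (Q (x ⊗ₜ (comul (R := 𝕜) y ⊗ₜ z))) =
      counit (R := 𝕜) y • ((1 : H) ⊗ₜ[𝕜] (antipode 𝕜 x * z)) := by
    intro x y z
    rw [← (ℛ 𝕜 y).eq]
    simp only [TensorProduct.sum_tmul, TensorProduct.tmul_sum, map_sum]
    have : ∀ i, W (Q (x ⊗ₜ[𝕜] (((ℛ 𝕜 y).left i ⊗ₜ[𝕜] (ℛ 𝕜 y).right i) ⊗ₜ[𝕜] z))) =
        (antipode 𝕜 ((ℛ 𝕜 y).left i) * (ℛ 𝕜 y).right i) ⊗ₜ (antipode 𝕜 x * z) := fun i => by simp [W, Q]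
    simp only [this]
    rw [← TensorProduct.sum_tmul, sum_antipode_mul_eq_smul, TensorProduct.smul_tmul']
  have h3 : W ∘ₗ Q ∘ₗ TensorProduct.map .id (TensorProduct.map comul .id ∘ₗ comul) =
      TensorProduct.mk 𝕜 H H 1 ∘ₗ LinearMap.mul' 𝕜 H ∘ₗ (antipode 𝕜).rTensor H := by
    ext x y
    simp only [TensorProduct.AlgebraTensorModule.curry_apply, LinearMap.restrictScalars_self,
      TensorProduct.curry_apply, LinearMap.coe_comp, Function.comp_apply,
      TensorProduct.map_tmul, LinearMap.id_apply, TensorProduct.mk_apply, LinearMap.rTensor_tmul,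
      LinearMap.mul'_apply]
    conv_lhs => rw [← (ℛ 𝕜 y).eq]
    simp only [map_sum, TensorProduct.map_tmul, TensorProduct.tmul_sum, LinearMap.id_apply, h2]
    simp only [← TensorProduct.tmul_smul, ← mul_smul_comm]
    rw [← TensorProduct.tmul_sum, ← Finset.mul_sum, sum_counit_smul]
  apply WithConv.ext
  ext h
  have h4 := LinearMap.congr_fun h1 h
  have h5 := LinearMap.congr_fun h3 (comul h)
  simp only [LinearMap.coe_comp, Function.comp_apply] at h4 h5
  have h6 : TensorProduct.map (TensorProduct.map (antipode 𝕜) (antipode 𝕜) ∘ₗ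
        (TensorProduct.comm 𝕜 H H).toLinearMap ∘ₗ comul) (comul (R := 𝕜) (A := H)) =
      TensorProduct.map (TensorProduct.map (antipode 𝕜) (antipode 𝕜) ∘ₗ
        (TensorProduct.comm 𝕜 H H).toLinearMap) .id ∘ₗ
        TensorProduct.map (comul (R := 𝕜) (A := H)) comul := by
    rw [← TensorProduct.map_comp]; rfl
  change LinearMap.mul' 𝕜 (H ⊗[𝕜] H) (TensorProduct.map (TensorProduct.map (antipode 𝕜)
    (antipode 𝕜) ∘ₗ (TensorProduct.comm 𝕜 H H).toLinearMap ∘ₗ comul)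
      (comul (R := 𝕜) (A := H)) (comul h)) = algebraMap 𝕜 (H ⊗[𝕜] H) (counit h)
  rw [h6]
  change W (TensorProduct.map (comul (R := 𝕜) (A := H)) comul (comul h)) = _
  rw [h4, h5, HopfAlgebra.mul_antipode_rTensor_comul_apply]
  simp [Algebra.algebraMap_eq_smul_one, Algebra.TensorProduct.one_def]

theorem comul_comp_antipode :
    comul ∘ₗ antipode 𝕜 (A := H) =
      TensorProduct.map (antipode 𝕜) (antipode 𝕜) ∘ₗ
        (TensorProduct.comm 𝕜 H H).toLinearMap ∘ₗ comul :=
  (WithConv.toConv_injective (left_inv_eq_right_inv (antipode_comul_left_inv 𝕜 H)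
    LinearMap.comul_right_inv)).symm

variable [HasBijectiveAntipode 𝕜 H]

/-- The antipode as a linear automorphism. -/
def antipodeEquiv : H ≃ₗ[𝕜] H :=
  LinearEquiv.ofBijective (HopfAlgebra.antipode 𝕜) HasBijectiveAntipode.bijective

/-- The inverse of the antipode. -/
def invAntipode : H →ₗ[𝕜] H := (antipodeEquiv 𝕜 H).symm.toLinearMap

variable {𝕜 H}

theorem antipode_invAntipode (x : H) : HopfAlgebra.antipode 𝕜 (invAntipode 𝕜 H x) = x :=
  (antipodeEquiv 𝕜 H).apply_symm_apply x

theorem invAntipode_antipode (x : H) : invAntipode 𝕜 H (HopfAlgebra.antipode 𝕜 x) = x :=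
  (antipodeEquiv 𝕜 H).symm_apply_apply x

theorem invAntipode_one : invAntipode 𝕜 H 1 = 1 := by
  conv_lhs => rw [← HopfAlgebra.antipode_one (R := 𝕜) (A := H)]
  exact invAntipode_antipode _

theorem invAntipode_mul (x y : H) :
    invAntipode 𝕜 H (x * y) = invAntipode 𝕜 H y * invAntipode 𝕜 H x := by
  apply (antipodeEquiv 𝕜 H).injective
  change HopfAlgebra.antipode 𝕜 _ = HopfAlgebra.antipode 𝕜 _
  rw [HopfAlgebra.antipode_mul_antidistrib]
  simp only [antipode_invAntipode]

theorem comul_invAntipode (x : H) :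
    comul (invAntipode 𝕜 H x) = TensorProduct.map (invAntipode 𝕜 H) (invAntipode 𝕜 H)
      (TensorProduct.comm 𝕜 H H (comul (R := 𝕜) x)) := by
  have h := LinearMap.congr_fun (comul_comp_antipode 𝕜 H) (invAntipode 𝕜 H x)
  simp only [LinearMap.coe_comp, Function.comp_apply, antipode_invAntipode,
    LinearEquiv.coe_coe] at h
  rw [h]
  generalize comul (R := 𝕜) (invAntipode 𝕜 H x) = z
  induction z with
  | zero => simp
  | add a b ha hb => simpa [map_add] using congr($ha + $hb)
  | tmul a b => simp [invAntipode_antipode]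

end InvAntipode

section Cop

/-- The co-opposite Hopf algebra: same algebra, flipped comultiplication, antipode inverted. -/
def Cop (_𝕜 : Type*) (H : Type*) : Type _ := H

variable (𝕜 : Type*) (H : Type*) [Field 𝕜] [Ring H] [HopfAlgebra 𝕜 H]

instance : Ring (Cop 𝕜 H) := inferInstanceAs (Ring H)

instance : Algebra 𝕜 (Cop 𝕜 H) := inferInstanceAs (Algebra 𝕜 H)

/-- The identity map of the underlying algebras. -/
def toCop : H ≃ₐ[𝕜] Cop 𝕜 H := AlgEquiv.refl

open Coalgebra HopfAlgebra

def copComul : Cop 𝕜 H →ₐ[𝕜] Cop 𝕜 H ⊗[𝕜] Cop 𝕜 H :=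
  ((Algebra.TensorProduct.comm 𝕜 H H).toAlgHom.comp (Bialgebra.comulAlgHom 𝕜 H) :
    H →ₐ[𝕜] H ⊗[𝕜] H)

def copCounit : Cop 𝕜 H →ₐ[𝕜] 𝕜 := Bialgebra.counitAlgHom 𝕜 H

theorem comm_comul_coassoc :
    (TensorProduct.assoc 𝕜 H H H).toLinearMap ∘ₗ
      TensorProduct.map ((TensorProduct.comm 𝕜 H H).toLinearMap ∘ₗ comul) .id ∘ₗ
        ((TensorProduct.comm 𝕜 H H).toLinearMap ∘ₗ comul) =
      TensorProduct.map .id ((TensorProduct.comm 𝕜 H H).toLinearMap ∘ₗ comul) ∘ₗ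
        ((TensorProduct.comm 𝕜 H H).toLinearMap ∘ₗ comul) := by
  let rev : H ⊗[𝕜] (H ⊗[𝕜] H) →ₗ[𝕜] H ⊗[𝕜] (H ⊗[𝕜] H) :=
    (TensorProduct.assoc 𝕜 H H H).toLinearMap ∘ₗ (TensorProduct.comm 𝕜 H (H ⊗[𝕜] H)).toLinearMap ∘ₗ
      TensorProduct.map .id (TensorProduct.comm 𝕜 H H).toLinearMap
  have h1 : ∀ x y z : H, rev (x ⊗ₜ (y ⊗ₜ z)) = z ⊗ₜ (y ⊗ₜ x) := fun x y z => by simp [rev]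
  have h2 : ∀ z : H ⊗[𝕜] H, TensorProduct.assoc 𝕜 H H H
      (TensorProduct.map ((TensorProduct.comm 𝕜 H H).toLinearMap ∘ₗ comul) .id
        (TensorProduct.comm 𝕜 H H z)) = rev ((comul (R := 𝕜)).lTensor H z) := by
    intro z
    induction z with
    | zero => simp
    | add a b ha hb => simp only [map_add, ha, hb]
    | tmul x y =>
      simp only [TensorProduct.comm_tmul, TensorProduct.map_tmul, LinearMap.lTensor_tmul,
        LinearMap.comp_apply, LinearEquiv.coe_coe, LinearMap.id_apply]
      generalize comul (R := 𝕜) y = w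
      induction w with
      | zero => simp
      | add a b ha hb =>
        simp only [map_add, TensorProduct.tmul_add, TensorProduct.add_tmul, ha, hb]
      | tmul a b => simp [h1]
  have h3 : ∀ z : H ⊗[𝕜] H,
      TensorProduct.map .id ((TensorProduct.comm 𝕜 H H).toLinearMap ∘ₗ comul)
        (TensorProduct.comm 𝕜 H H z) =
      rev (TensorProduct.assoc 𝕜 H H H ((comul (R := 𝕜)).rTensor H z)) := by
    intro z
    induction z with
    | zero => simp
    | add a b ha hb => simp only [map_add, ha, hb]
    | tmul x y =>
      simp only [TensorProduct.comm_tmul, TensorProduct.map_tmul, LinearMap.rTensor_tmul,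
        LinearMap.comp_apply, LinearEquiv.coe_coe, LinearMap.id_apply]
      generalize comul (R := 𝕜) x = w
      induction w with
      | zero => simp
      | add a b ha hb =>
        simp only [map_add, TensorProduct.tmul_add, TensorProduct.add_tmul, ha, hb]
      | tmul a b => simp [h1]
  ext h
  refine (h2 _).trans (Eq.trans ?_ (h3 _).symm)
  rw [Coalgebra.coassoc_apply]

theorem comm_comul_counit_left :
    TensorProduct.map counit .id ∘ₗ ((TensorProduct.comm 𝕜 H H).toLinearMap ∘ₗ comul) =
      (TensorProduct.lid 𝕜 H).symm.toLinearMap := by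
  ext h
  have := Coalgebra.lTensor_counit_comul (R := 𝕜) h
  simp only [LinearMap.coe_comp, Function.comp_apply, LinearEquiv.coe_coe,
    TensorProduct.map_comm, LinearMap.lTensor_def] at this ⊢
  rw [this]
  simp

theorem comm_comul_counit_right :
    TensorProduct.map .id counit ∘ₗ ((TensorProduct.comm 𝕜 H H).toLinearMap ∘ₗ comul) =
      (TensorProduct.rid 𝕜 H).symm.toLinearMap := by
  ext h
  have := Coalgebra.rTensor_counit_comul (R := 𝕜) h
  simp only [LinearMap.coe_comp, Function.comp_apply, LinearEquiv.coe_coe,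
    TensorProduct.map_comm, LinearMap.rTensor_def] at this ⊢
  rw [this]
  simp

instance : Bialgebra 𝕜 (Cop 𝕜 H) :=
  Bialgebra.ofAlgHom (copComul 𝕜 H) (copCounit 𝕜 H)
    (AlgHom.toLinearMap_injective (comm_comul_coassoc 𝕜 H))
    (AlgHom.toLinearMap_injective (comm_comul_counit_left 𝕜 H))
    (AlgHom.toLinearMap_injective (comm_comul_counit_right 𝕜 H))

variable [HasBijectiveAntipode 𝕜 H]

theorem invAntipode_cop_left (h : H) :
    LinearMap.mul' 𝕜 H ((invAntipode 𝕜 H).rTensor H (TensorProduct.comm 𝕜 H H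
      (comul (R := 𝕜) h))) = algebraMap 𝕜 H (counit h) := by
  apply (antipodeEquiv 𝕜 H).injective
  have h1 : ∀ z : H ⊗[𝕜] H, antipode 𝕜 (LinearMap.mul' 𝕜 H ((invAntipode 𝕜 H).rTensor H
      (TensorProduct.comm 𝕜 H H z))) =
      LinearMap.mul' 𝕜 H ((antipode 𝕜).rTensor H z) := by
    intro z
    induction z with
    | zero => simp
    | add a b ha hb => simpa [map_add] using congr($ha + $hb)
    | tmul a b => simp [antipode_mul_antidistrib, antipode_invAntipode]
  refine (h1 _).trans ?_
  rw [mul_antipode_rTensor_comul_apply]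
  change _ = antipode 𝕜 _
  rw [Algebra.algebraMap_eq_smul_one, map_smul, antipode_one]

theorem invAntipode_cop_right (h : H) :
    LinearMap.mul' 𝕜 H ((invAntipode 𝕜 H).lTensor H (TensorProduct.comm 𝕜 H H
      (comul (R := 𝕜) h))) = algebraMap 𝕜 H (counit h) := by
  apply (antipodeEquiv 𝕜 H).injective
  have h1 : ∀ z : H ⊗[𝕜] H, antipode 𝕜 (LinearMap.mul' 𝕜 H ((invAntipode 𝕜 H).lTensor H
      (TensorProduct.comm 𝕜 H H z))) =
      LinearMap.mul' 𝕜 H ((antipode 𝕜).lTensor H z) := by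
    intro z
    induction z with
    | zero => simp
    | add a b ha hb => simpa [map_add] using congr($ha + $hb)
    | tmul a b => simp [antipode_mul_antidistrib, antipode_invAntipode]
  refine (h1 _).trans ?_
  rw [mul_antipode_lTensor_comul_apply]
  change _ = antipode 𝕜 _
  rw [Algebra.algebraMap_eq_smul_one, map_smul, antipode_one]

instance : HopfAlgebra 𝕜 (Cop 𝕜 H) where
  antipode := (invAntipode 𝕜 H : H →ₗ[𝕜] H)
  mul_antipode_rTensor_comul := LinearMap.ext (invAntipode_cop_left 𝕜 H)
  mul_antipode_lTensor_comul := LinearMap.ext (invAntipode_cop_right 𝕜 H)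

instance : HasBijectiveAntipode 𝕜 (Cop 𝕜 H) where
  bijective := (antipodeEquiv 𝕜 H).symm.bijective

theorem invAntipode_toCop (h : H) :
    invAntipode 𝕜 (Cop 𝕜 H) (toCop 𝕜 H h) = toCop 𝕜 H (antipode 𝕜 h) := by
  apply (antipodeEquiv 𝕜 (Cop 𝕜 H)).injective
  refine (antipode_invAntipode (𝕜 := 𝕜) (H := Cop 𝕜 H) _).trans ?_
  exact (invAntipode_antipode h).symm

end Cop

section Double

variable (𝕜 : Type*) (H : Type*) [Field 𝕜] [Ring H] [HopfAlgebra 𝕜 H]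

open Coalgebra HopfAlgebra

/-- The dual algebra of the coalgebra `H`: its multiplication is the convolution product. -/
abbrev DualAlg : Type _ := WithConv (H →ₗ[𝕜] 𝕜)

/-- The iterated comultiplication `h ↦ h₁ ⊗ (h₂ ⊗ h₃)`. -/
def comul3 : H →ₗ[𝕜] H ⊗[𝕜] (H ⊗[𝕜] H) := (comul (R := 𝕜)).lTensor H ∘ₗ comul

theorem tensor3_induction {𝕜 : Type*} [Field 𝕜] {M : Type*} [AddCommGroup M] [Module 𝕜 M]
    {P : M ⊗[𝕜] (M ⊗[𝕜] M) → Prop} (h0 : P 0) (hadd : ∀ a b, P a → P b → P (a + b))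
    (ht : ∀ x y z : M, P (x ⊗ₜ (y ⊗ₜ z))) (w : M ⊗[𝕜] (M ⊗[𝕜] M)) : P w := by
  induction w with
  | zero => exact h0
  | add a b ha hb => exact hadd a b ha hb
  | tmul x w =>
    induction w with
    | zero => simpa using h0
    | add a b ha hb => rw [TensorProduct.tmul_add]; exact hadd _ _ ha hb
    | tmul y z => exact ht x y z

theorem comul3_one : comul3 𝕜 H 1 = 1 := by
  simp [comul3, Algebra.TensorProduct.one_def]

theorem comul3_mul (x y : H) : comul3 𝕜 H (x * y) = comul3 𝕜 H x * comul3 𝕜 H y :=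
  map_mul ((Algebra.TensorProduct.map (.id 𝕜 H) (Bialgebra.comulAlgHom 𝕜 H)).comp
    (Bialgebra.comulAlgHom 𝕜 H)) x y

/-- Left multiplication by `f ⋈ 1`, i.e. `g ⊗ k ↦ f g ⊗ k`. -/
def leftDual : DualAlg 𝕜 H →ₗ[𝕜] Module.End 𝕜 (DualAlg 𝕜 H ⊗[𝕜] H) :=
  LinearMap.rTensorHom H ∘ₗ LinearMap.mul 𝕜 (DualAlg 𝕜 H)

@[simp] theorem leftDual_tmul (f g : DualAlg 𝕜 H) (k : H) :
    leftDual 𝕜 H f (g ⊗ₜ k) = (f * g) ⊗ₜ k := rfl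

theorem comul3_assoc :
    TensorProduct.map comul (TensorProduct.map .id comul) ∘ₗ comul3 𝕜 H =
      (TensorProduct.assoc 𝕜 H H _).symm.toLinearMap ∘ₗ
        TensorProduct.map .id (TensorProduct.map .id (TensorProduct.assoc 𝕜 H H _).toLinearMap ∘ₗ
          (TensorProduct.assoc 𝕜 H (H ⊗[𝕜] H) H).toLinearMap ∘ₗ
          TensorProduct.map (comul3 𝕜 H) .id) ∘ₗ comul3 𝕜 H := by
  simp only [comul3, coassoc_simps]

variable [HasBijectiveAntipode 𝕜 H]

/-- The functional `u ↦ f (S⁻¹(q) * u * p)`, for `p q : H`. -/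
def coadjFun (p q : H) : DualAlg 𝕜 H →ₗ[𝕜] DualAlg 𝕜 H where
  toFun f := toConv (f.ofConv ∘ₗ LinearMap.mulRight 𝕜 p ∘ₗ
    LinearMap.mulLeft 𝕜 (invAntipode 𝕜 H q))
  map_add' _ _ := rfl
  map_smul' _ _ := rfl

theorem coadjFun_apply (p q : H) (f : DualAlg 𝕜 H) (u : H) :
    (coadjFun 𝕜 H p q f).ofConv u = f.ofConv (invAntipode 𝕜 H q * u * p) := rfl

theorem coadjFun_mul (p q p' q' : H) (f : DualAlg 𝕜 H) :
    coadjFun 𝕜 H (p * p') (q * q') f = coadjFun 𝕜 H p q (coadjFun 𝕜 H p' q' f) := by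
  ext u
  simp [coadjFun_apply, invAntipode_mul, mul_assoc]

/-- `coadjFun` as a bilinear map. -/
def coadj : H →ₗ[𝕜] H →ₗ[𝕜] DualAlg 𝕜 H →ₗ[𝕜] DualAlg 𝕜 H :=
  LinearMap.mk₂ 𝕜 (coadjFun 𝕜 H)
    (fun p p' q => by ext f u; simp [coadjFun_apply, mul_add])
    (fun c p q => by ext f u; simp [coadjFun_apply])
    (fun p q q' => by ext f u; simp [coadjFun_apply, add_mul])
    (fun c p q => by ext f u; simp [coadjFun_apply])

@[simp] theorem coadj_apply (p q : H) : coadj 𝕜 H p q = coadjFun 𝕜 H p q := rfl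

/-- `p ⊗ (m ⊗ q)` acts on `H* ⊗ H` by `g ⊗ k ↦ g (S⁻¹(q) ? p) ⊗ m k`. -/
def straighten : H ⊗[𝕜] (H ⊗[𝕜] H) →ₗ[𝕜] Module.End 𝕜 (DualAlg 𝕜 H ⊗[𝕜] H) :=
  TensorProduct.lift (LinearMap.mk₂ 𝕜
    (fun p z => TensorProduct.lift (((TensorProduct.mapBilinear (RingHom.id 𝕜) (DualAlg 𝕜 H) H
      (DualAlg 𝕜 H) H).compl₁₂ (coadj 𝕜 H p) (LinearMap.mul 𝕜 H)).flip) z)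
    (fun p p' z => by
      induction z with
      | zero => simp
      | add a b ha hb => rw [map_add, ha, hb, map_add, map_add]; abel
      | tmul m q => ext; simp)
    (fun c p z => by
      induction z with
      | zero => simp
      | add a b ha hb => simp only [map_add, ha, hb, smul_add]
      | tmul m q => ext; simp [TensorProduct.smul_tmul'])
    (fun p z z' => map_add _ z z')
    (fun c p z => map_smul _ c z))

@[simp] theorem straighten_tmul (p m q : H) (g : DualAlg 𝕜 H) (k : H) :
    straighten 𝕜 H (p ⊗ₜ (m ⊗ₜ q)) (g ⊗ₜ k) = coadjFun 𝕜 H p q g ⊗ₜ (m * k) := rfl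

theorem straighten_mul (w w' : H ⊗[𝕜] (H ⊗[𝕜] H)) :
    straighten 𝕜 H (w * w') = straighten 𝕜 H w * straighten 𝕜 H w' := by
  induction w using tensor3_induction with
  | h0 => simp
  | hadd a b ha hb => simp only [add_mul, map_add, ha, hb]
  | ht x y z =>
    induction w' using tensor3_induction with
    | h0 => simp
    | hadd a b ha hb => simp only [mul_add, map_add, ha, hb]
    | ht x' y' z' =>
      apply TensorProduct.ext'
      intro g k
      simp [coadjFun_mul, mul_assoc]

theorem straighten_one : straighten 𝕜 H 1 = 1 := by
  apply TensorProduct.ext'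
  intro g k
  have : coadjFun 𝕜 H 1 1 g = g := by
    ext u; simp [coadjFun_apply, invAntipode_one]
  change straighten 𝕜 H (1 ⊗ₜ (1 ⊗ₜ 1)) (g ⊗ₜ k) = g ⊗ₜ k
  simp [this]

/-- The operator `g ⊗ k ↦ ∑ g (S⁻¹(h₃) ? h₁) ⊗ h₂ k`: left multiplication by `ε ⋈ h`. -/
def leftH : H →ₗ[𝕜] Module.End 𝕜 (DualAlg 𝕜 H ⊗[𝕜] H) := straighten 𝕜 H ∘ₗ comul3 𝕜 H

theorem leftH_mul (x y : H) : leftH 𝕜 H (x * y) = leftH 𝕜 H x * leftH 𝕜 H y := by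
  simp [leftH, comul3_mul, straighten_mul]

theorem leftH_one : leftH 𝕜 H 1 = 1 := by
  simp [leftH, comul3_one, straighten_one]

/-- The multiplication of the Drinfeld double. -/
def doubleMul : DualAlg 𝕜 H ⊗[𝕜] H →ₗ[𝕜] Module.End 𝕜 (DualAlg 𝕜 H ⊗[𝕜] H) :=
  TensorProduct.lift ((LinearMap.mul 𝕜 (Module.End 𝕜 (DualAlg 𝕜 H ⊗[𝕜] H))).compl₁₂
    (leftDual 𝕜 H) (leftH 𝕜 H))

theorem doubleMul_tmul (f : DualAlg 𝕜 H) (h : H) :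
    doubleMul 𝕜 H (f ⊗ₜ h) = leftDual 𝕜 H f * leftH 𝕜 H h := rfl

theorem doubleMul_leftDual (f : DualAlg 𝕜 H) (z : DualAlg 𝕜 H ⊗[𝕜] H) :
    doubleMul 𝕜 H (leftDual 𝕜 H f z) = leftDual 𝕜 H f * doubleMul 𝕜 H z := by
  induction z with
  | zero => simp
  | add a b ha hb => simp only [map_add, ha, hb, mul_add]
  | tmul g k =>
    rw [leftDual_tmul, doubleMul_tmul, doubleMul_tmul, ← mul_assoc]
    congr 1
    apply TensorProduct.ext'
    intro a b
    simp [mul_assoc]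

theorem doubleMul_mulRight (k : H) (z : DualAlg 𝕜 H ⊗[𝕜] H) :
    doubleMul 𝕜 H ((LinearMap.mulRight 𝕜 k).lTensor _ z) =
      doubleMul 𝕜 H z * leftH 𝕜 H k := by
  induction z with
  | zero => simp
  | add a b ha hb => simp only [map_add, ha, hb, add_mul]
  | tmul g h => simp [doubleMul_tmul, leftH_mul, mul_assoc]

theorem straighten_mulRight (w : H ⊗[𝕜] (H ⊗[𝕜] H)) (g : DualAlg 𝕜 H) (k : H) :
    straighten 𝕜 H w (g ⊗ₜ k) =
      (LinearMap.mulRight 𝕜 k).lTensor _ (straighten 𝕜 H w (g ⊗ₜ 1)) := by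
  induction w using tensor3_induction with
  | h0 => simp
  | hadd a b ha hb => simp only [map_add, LinearMap.add_apply, ha, hb]
  | ht x y z => simp

/-- `(p₁, q₂) · g` times `(p₂, q₁) · a`, as a function of `Δ p` and `Δ q`. -/
def prodPair (g a : DualAlg 𝕜 H) : (H ⊗[𝕜] H) ⊗[𝕜] (H ⊗[𝕜] H) →ₗ[𝕜] DualAlg 𝕜 H :=
  LinearMap.mul' 𝕜 (DualAlg 𝕜 H) ∘ₗ
    TensorProduct.map (TensorProduct.lift ((coadj 𝕜 H).compr₂ (LinearMap.applyₗ g)))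
      (TensorProduct.lift ((coadj 𝕜 H).compr₂ (LinearMap.applyₗ a))) ∘ₗ
    (TensorProduct.tensorTensorTensorComm 𝕜 H H H H).toLinearMap ∘ₗ
    TensorProduct.map .id (TensorProduct.comm 𝕜 H H).toLinearMap

theorem prodPair_tmul (g a : DualAlg 𝕜 H) (p p' q q' : H) :
    prodPair 𝕜 H g a ((p ⊗ₜ p') ⊗ₜ (q ⊗ₜ q')) =
      coadjFun 𝕜 H p q' g * coadjFun 𝕜 H p' q a := rfl

theorem coadjFun_convMul (p q : H) (g a : DualAlg 𝕜 H) :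
    coadjFun 𝕜 H p q (g * a) = prodPair 𝕜 H g a (comul p ⊗ₜ comul q) := by
  ext u
  rw [coadjFun_apply]
  have h1 : ∀ x : H, (g * a).ofConv x = LinearMap.mul' 𝕜 𝕜
      (TensorProduct.map g.ofConv a.ofConv (comul x)) := fun x => rfl
  rw [h1, Bialgebra.comul_mul, Bialgebra.comul_mul, comul_invAntipode]
  generalize comul (R := 𝕜) p = P
  generalize comul (R := 𝕜) q = Q
  induction P with
  | zero => simp
  | add x y hx hy =>
    simp only [mul_add, map_add, TensorProduct.add_tmul, hx, hy]
    rfl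
  | tmul p p' =>
    induction Q with
    | zero => simp
    | add x y hx hy =>
      simp only [add_mul, map_add, TensorProduct.tmul_add, hx, hy]
      rfl
    | tmul q q' =>
      rw [prodPair_tmul]
      change _ = LinearMap.mul' 𝕜 𝕜 (TensorProduct.map (coadjFun 𝕜 H p q' g).ofConv
        (coadjFun 𝕜 H p' q a).ofConv (comul u))
      generalize comul (R := 𝕜) u = U
      induction U with
      | zero => simp
      | add x y hx hy => simp only [mul_add, add_mul, map_add, hx, hy]
      | tmul u u' => simp [coadjFun_apply]

/-- `(x₁ ⊗ x₂) ⊗ (x₃ ⊗ (x₄ ⊗ x₅)) ↦ ((x₁, x₅) · g) ((x₂, x₄) · a) ⊗ x₃ l`. -/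
def fiveMap (g a : DualAlg 𝕜 H) (l : H) :
    (H ⊗[𝕜] H) ⊗[𝕜] (H ⊗[𝕜] (H ⊗[𝕜] H)) →ₗ[𝕜] DualAlg 𝕜 H ⊗[𝕜] H :=
  TensorProduct.map (prodPair 𝕜 H g a) (LinearMap.mulRight 𝕜 l) ∘ₗ
    (TensorProduct.assoc 𝕜 _ _ _).symm.toLinearMap ∘ₗ
    TensorProduct.map .id (TensorProduct.comm 𝕜 _ _).toLinearMap

theorem leftH_mul_leftDual (h : H) (g : DualAlg 𝕜 H) :
    leftH 𝕜 H h * leftDual 𝕜 H g = doubleMul 𝕜 H (leftH 𝕜 H h (g ⊗ₜ 1)) := by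
  apply TensorProduct.ext'
  intro a l
  have key := congr(fiveMap 𝕜 H g a l $(LinearMap.congr_fun (comul3_assoc 𝕜 H) h))
  simp only [LinearMap.coe_comp, Function.comp_apply] at key
  simp only [leftH, Module.End.mul_apply, leftDual_tmul, LinearMap.coe_comp, Function.comp_apply]
  generalize comul3 𝕜 H h = w at *
  refine Eq.trans ?_ (key.trans ?_)
  · clear key
    induction w using tensor3_induction with
    | h0 => simp
    | hadd a b ha hb => simp only [map_add, LinearMap.add_apply, ha, hb]
    | ht x y z =>
      rw [straighten_tmul, coadjFun_convMul]
      rfl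
  · clear key
    induction w using tensor3_induction with
    | h0 => simp
    | hadd a b ha hb => simp only [map_add, LinearMap.add_apply, ha, hb]
    | ht x y z =>
      rw [straighten_tmul, mul_one, doubleMul_tmul]
      simp only [TensorProduct.map_tmul, LinearMap.id_apply, LinearMap.coe_comp,
        Function.comp_apply, Module.End.mul_apply, leftH]
      generalize comul3 𝕜 H y = v
      induction v using tensor3_induction with
      | h0 => simp
      | hadd a b ha hb => 
        simp only [map_add, LinearMap.add_apply, ha, hb, TensorProduct.add_tmul,
          TensorProduct.tmul_add]
      | ht x' y' z' => rfl

theorem doubleMul_assoc (w z : DualAlg 𝕜 H ⊗[𝕜] H) :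
    doubleMul 𝕜 H (doubleMul 𝕜 H w z) = doubleMul 𝕜 H w * doubleMul 𝕜 H z := by
  induction w with
  | zero => simp
  | add a b ha hb => simp only [map_add, LinearMap.add_apply, ha, hb, add_mul]
  | tmul f h =>
    induction z with
    | zero => simp
    | add a b ha hb => simp only [map_add, ha, hb, mul_add]
    | tmul g k =>
      rw [doubleMul_tmul, Module.End.mul_apply, doubleMul_leftDual, mul_assoc, doubleMul_tmul,
        ← mul_assoc (leftH 𝕜 H h), leftH_mul_leftDual]
      congr 1
      rw [← doubleMul_mulRight]
      congr 1
      exact straighten_mulRight 𝕜 H _ g k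

theorem doubleMul_one : doubleMul 𝕜 H (1 ⊗ₜ 1) = 1 := by
  rw [doubleMul_tmul, leftH_one, mul_one]
  apply TensorProduct.ext'
  intro a b
  simp

theorem counit_invAntipode (h : H) : counit (R := 𝕜) (invAntipode 𝕜 H h) = counit h := by
  rw [← HopfAlgebra.counit_antipode, antipode_invAntipode]

theorem coadjFun_one (p q : H) :
    coadjFun 𝕜 H p q 1 = (counit (R := 𝕜) p * counit (R := 𝕜) q) • 1 := by
  ext u
  rw [coadjFun_apply]
  change counit (R := 𝕜) _ = _ * counit (R := 𝕜) u
  simp only [Bialgebra.counit_mul, counit_invAntipode]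
  ring

theorem leftH_apply_one (h : H) : leftH 𝕜 H h (1 ⊗ₜ 1) = 1 ⊗ₜ h := by
  have h1 : ∀ w : H ⊗[𝕜] (H ⊗[𝕜] H), straighten 𝕜 H w (1 ⊗ₜ 1) =
      1 ⊗ₜ (TensorProduct.lid 𝕜 H (TensorProduct.map counit ((TensorProduct.rid 𝕜 H).toLinearMap ∘ₗ
        (counit (R := 𝕜)).lTensor H) w)) := by
    intro w
    induction w using tensor3_induction with
    | h0 => simp
    | hadd a b ha hb => simp only [map_add, LinearMap.add_apply, ha, hb, TensorProduct.tmul_add]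
    | ht x y z =>
      simp only [straighten_tmul, coadjFun_one, mul_one, TensorProduct.smul_tmul, mul_smul,
        TensorProduct.map_tmul, LinearMap.comp_apply, LinearMap.lTensor_tmul, LinearEquiv.coe_coe,
        TensorProduct.rid_tmul, TensorProduct.lid_tmul]
      rw [smul_comm]
  have h2 : TensorProduct.map (counit (R := 𝕜)) ((TensorProduct.rid 𝕜 H).toLinearMap ∘ₗ
      (counit (R := 𝕜)).lTensor H) (comul3 𝕜 H h) = 1 ⊗ₜ h := by
    rw [← Coalgebra.rTensor_counit_comul (R := 𝕜) h]
    simp only [comul3, LinearMap.comp_apply]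
    generalize comul (R := 𝕜) h = z
    induction z with
    | zero => simp
    | add a b ha hb => simp only [map_add, ha, hb]
    | tmul x y => simp
  simp [leftH, h1, h2]

theorem doubleMul_apply_one (w : DualAlg 𝕜 H ⊗[𝕜] H) : doubleMul 𝕜 H w (1 ⊗ₜ 1) = w := by
  induction w with
  | zero => simp
  | add a b ha hb => simp only [map_add, LinearMap.add_apply, ha, hb]
  | tmul f h => simp [doubleMul_tmul, leftH_apply_one]

/-- The Drinfeld double `D(H)`: the vector space `H* ⊗ H` with product
`(f ⋈ h)(g ⋈ k) = ∑ f g(S⁻¹(h₃) ? h₁) ⋈ h₂ k`, where `f` is multiplied by the functional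
`u ↦ g(S⁻¹(h₃) u h₁)` with the convolution product.  With the coadjoint actions
`(h ⇀ f)(u) = ∑ f(S⁻¹(h₂) u h₁)` and `h ↼ f = ∑ f(S⁻¹(h₃) h₁) h₂` this is the product
`∑ f (h₁ ⇀ g₂) ⋈ (h₂ ↼ g₁) k`, because `∑ h₂ S⁻¹(h₁) = ε(h) 1`. -/
def DrinfeldDouble : Type _ := DualAlg 𝕜 H ⊗[𝕜] H

instance : AddCommGroup (DrinfeldDouble 𝕜 H) :=
  inferInstanceAs (AddCommGroup (DualAlg 𝕜 H ⊗[𝕜] H))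

instance : Module 𝕜 (DrinfeldDouble 𝕜 H) :=
  inferInstanceAs (Module 𝕜 (DualAlg 𝕜 H ⊗[𝕜] H))

/-- The element `f ⋈ h` of the Drinfeld double. -/
def bowtie (f : DualAlg 𝕜 H) (h : H) : DrinfeldDouble 𝕜 H := f ⊗ₜ[𝕜] h

instance : Ring (DrinfeldDouble 𝕜 H) :=
  { (inferInstance : AddCommGroup (DrinfeldDouble 𝕜 H)) with
    mul := fun x y => doubleMul 𝕜 H x y
    one := bowtie 𝕜 H 1 1
    mul_assoc := fun x y z => LinearMap.congr_fun (doubleMul_assoc 𝕜 H x y) z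
    one_mul := fun x => LinearMap.congr_fun (doubleMul_one 𝕜 H) x
    mul_one := fun x => doubleMul_apply_one 𝕜 H x
    left_distrib := fun x y z => map_add (doubleMul 𝕜 H x) y z
    right_distrib := fun x y z => LinearMap.congr_fun (map_add (doubleMul 𝕜 H) x y) z
    zero_mul := fun x => LinearMap.congr_fun (map_zero (doubleMul 𝕜 H)) x
    mul_zero := fun x => map_zero (doubleMul 𝕜 H x) }

instance : Algebra 𝕜 (DrinfeldDouble 𝕜 H) :=
  Algebra.ofModule
    (fun c x y => LinearMap.congr_fun (map_smul (doubleMul 𝕜 H) c x) y)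
    (fun c x y => map_smul (doubleMul 𝕜 H x) c y)

theorem bowtie_mul_bowtie (f g : DualAlg 𝕜 H) (h k : H) :
    bowtie 𝕜 H f h * bowtie 𝕜 H g k =
      leftDual 𝕜 H f (straighten 𝕜 H (comul3 𝕜 H h) (g ⊗ₜ k)) := rfl

theorem DrinfeldDouble.one_def : (1 : DrinfeldDouble 𝕜 H) = bowtie 𝕜 H 1 1 := rfl

end Double

section HopfConstructor

open Coalgebra

theorem antipode_left_of_generators {𝕜 A : Type*} [Field 𝕜] [Ring A] [Bialgebra 𝕜 A]
    (S : A →ₐ[𝕜] Aᵐᵒᵖ) (s : Set A) (hs : Algebra.adjoin 𝕜 s = ⊤)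
    (h : ∀ x ∈ s, LinearMap.mul' 𝕜 A
      ((((MulOpposite.opLinearEquiv 𝕜).symm.toLinearMap ∘ₗ S.toLinearMap) : A →ₗ[𝕜] A).rTensor A
        (comul x)) = algebraMap 𝕜 A (counit x)) (x : A) :
    LinearMap.mul' 𝕜 A
      ((((MulOpposite.opLinearEquiv 𝕜).symm.toLinearMap ∘ₗ S.toLinearMap) : A →ₗ[𝕜] A).rTensor A
        (comul x)) = algebraMap 𝕜 A (counit x) := by
  set T : A →ₗ[𝕜] A := (MulOpposite.opLinearEquiv 𝕜).symm.toLinearMap ∘ₗ S.toLinearMap with hT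
  have hT1 : T 1 = 1 := by simp [hT]
  have hTm : ∀ a b, T (a * b) = T b * T a := fun a b => by simp [hT]
  have hx : x ∈ Algebra.adjoin 𝕜 s := hs ▸ Algebra.mem_top
  induction hx using Algebra.adjoin_induction with
  | mem x hx => exact h x hx
  | algebraMap r => simp [Algebra.TensorProduct.one_def, Algebra.algebraMap_eq_smul_one, hT1]
  | add x y _ _ hx hy => simp only [map_add, hx, hy]
  | mul x y _ _ hx hy =>
    have key : ∀ P Q : A ⊗[𝕜] A, ∀ c : 𝕜, LinearMap.mul' 𝕜 A (T.rTensor A P) = algebraMap 𝕜 A c →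
        LinearMap.mul' 𝕜 A (T.rTensor A (P * Q)) =
          algebraMap 𝕜 A c * LinearMap.mul' 𝕜 A (T.rTensor A Q) := by
      intro P Q c hP
      induction Q with
      | zero => simp
      | add a b ha hb => simp only [mul_add, map_add, ha, hb]
      | tmul a b =>
        have : ∀ P : A ⊗[𝕜] A, LinearMap.mul' 𝕜 A (T.rTensor A (P * (a ⊗ₜ b))) =
            T a * LinearMap.mul' 𝕜 A (T.rTensor A P) * b := by
          intro P
          induction P with
          | zero => simp
          | add u v hu hv => simp only [add_mul, mul_add, map_add, hu, hv]
          | tmul u v => simp [hTm, mul_assoc]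
        rw [this, hP]
        simp only [LinearMap.rTensor_tmul, LinearMap.mul'_apply]
        rw [← Algebra.commutes, mul_assoc]
    rw [Bialgebra.comul_mul, key _ _ _ hx, hy, Bialgebra.counit_mul, map_mul]

theorem antipode_right_of_generators {𝕜 A : Type*} [Field 𝕜] [Ring A] [Bialgebra 𝕜 A]
    (S : A →ₐ[𝕜] Aᵐᵒᵖ) (s : Set A) (hs : Algebra.adjoin 𝕜 s = ⊤)
    (h : ∀ x ∈ s, LinearMap.mul' 𝕜 A
      ((((MulOpposite.opLinearEquiv 𝕜).symm.toLinearMap ∘ₗ S.toLinearMap) : A →ₗ[𝕜] A).lTensor A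
        (comul x)) = algebraMap 𝕜 A (counit x)) (x : A) :
    LinearMap.mul' 𝕜 A
      ((((MulOpposite.opLinearEquiv 𝕜).symm.toLinearMap ∘ₗ S.toLinearMap) : A →ₗ[𝕜] A).lTensor A
        (comul x)) = algebraMap 𝕜 A (counit x) := by
  set T : A →ₗ[𝕜] A := (MulOpposite.opLinearEquiv 𝕜).symm.toLinearMap ∘ₗ S.toLinearMap with hT
  have hT1 : T 1 = 1 := by simp [hT]
  have hTm : ∀ a b, T (a * b) = T b * T a := fun a b => by simp [hT]
  have hx : x ∈ Algebra.adjoin 𝕜 s := hs ▸ Algebra.mem_top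
  induction hx using Algebra.adjoin_induction with
  | mem x hx => exact h x hx
  | algebraMap r => simp [Algebra.TensorProduct.one_def, Algebra.algebraMap_eq_smul_one, hT1]
  | add x y _ _ hx hy => simp only [map_add, hx, hy]
  | mul x y _ _ hx hy =>
    have key : ∀ P Q : A ⊗[𝕜] A, ∀ c : 𝕜, LinearMap.mul' 𝕜 A (T.lTensor A Q) = algebraMap 𝕜 A c →
        LinearMap.mul' 𝕜 A (T.lTensor A (P * Q)) =
          LinearMap.mul' 𝕜 A (T.lTensor A P) * algebraMap 𝕜 A c := by
      intro P Q c hQ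
      induction P with
      | zero => simp
      | add a b ha hb => simp only [add_mul, map_add, ha, hb]
      | tmul a b =>
        have : ∀ Q : A ⊗[𝕜] A, LinearMap.mul' 𝕜 A (T.lTensor A ((a ⊗ₜ b) * Q)) =
            a * LinearMap.mul' 𝕜 A (T.lTensor A Q) * T b := by
          intro Q
          induction Q with
          | zero => simp
          | add u v hu hv => simp only [add_mul, mul_add, map_add, hu, hv]
          | tmul u v => simp [hTm, mul_assoc]
        rw [this, hQ]
        simp only [LinearMap.lTensor_tmul, LinearMap.mul'_apply]
        rw [mul_assoc, Algebra.commutes, mul_assoc]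
    rw [Bialgebra.comul_mul, key _ _ _ hy, hx, Bialgebra.counit_mul, map_mul]

end HopfConstructor

section KAlgebra

/-- The four generators of the algebra `K`. -/
inductive KGen
  | a | b | c | d

open FreeAlgebra in
/-- The defining relations of the algebra `K`. -/
inductive KRel {𝕜 : Type*} [Field 𝕜] (ξ : 𝕜) : FreeAlgebra 𝕜 KGen → FreeAlgebra 𝕜 KGen → Prop
  | ab : KRel ξ (ι 𝕜 .a * ι 𝕜 .b) (ξ • (ι 𝕜 .b * ι 𝕜 .a))
  | ac : KRel ξ (ι 𝕜 .a * ι 𝕜 .c) (ξ • (ι 𝕜 .c * ι 𝕜 .a))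
  | cb : KRel ξ (ι 𝕜 .c * ι 𝕜 .b) 0
  | bc : KRel ξ (ι 𝕜 .b * ι 𝕜 .c) 0
  | cd : KRel ξ (ι 𝕜 .c * ι 𝕜 .d) (ξ • (ι 𝕜 .d * ι 𝕜 .c))
  | bd : KRel ξ (ι 𝕜 .b * ι 𝕜 .d) (ξ • (ι 𝕜 .d * ι 𝕜 .b))
  | ad_da : KRel ξ (ι 𝕜 .a * ι 𝕜 .d) (ι 𝕜 .d * ι 𝕜 .a)
  | ad : KRel ξ (ι 𝕜 .a * ι 𝕜 .d) 1
  | bb : KRel ξ (ι 𝕜 .b ^ 2) 0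
  | cc : KRel ξ (ι 𝕜 .c ^ 2) 0
  | aac : KRel ξ (ι 𝕜 .a ^ 2 * ι 𝕜 .c) (ι 𝕜 .b)
  | aaaa : KRel ξ (ι 𝕜 .a ^ 4) 1

/-- The algebra `K`, generated by `a, b, c, d` subject to `KRel`. -/
def KAlg {𝕜 : Type*} [Field 𝕜] {ξ : 𝕜} (_hξ : IsPrimitiveRoot ξ 4) : Type _ := RingQuot (KRel ξ)

variable {𝕜 : Type*} [Field 𝕜] {ξ : 𝕜} (hξ : IsPrimitiveRoot ξ 4)

namespace KAlg

instance : Ring (KAlg hξ) := inferInstanceAs (Ring (RingQuot (KRel ξ)))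

instance : Algebra 𝕜 (KAlg hξ) := inferInstanceAs (Algebra 𝕜 (RingQuot (KRel ξ)))

/-- The quotient map from the free algebra. -/
def proj : FreeAlgebra 𝕜 KGen →ₐ[𝕜] KAlg hξ := RingQuot.mkAlgHom 𝕜 (KRel ξ)

def gen (i : KGen) : KAlg hξ := proj hξ (FreeAlgebra.ι 𝕜 i)

def a : KAlg hξ := gen hξ .a
def b : KAlg hξ := gen hξ .b
def c : KAlg hξ := gen hξ .c
def d : KAlg hξ := gen hξ .d

variable {hξ}

theorem proj_eq_of_rel {x y : FreeAlgebra 𝕜 KGen} (h : KRel ξ x y) : proj hξ x = proj hξ y :=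
  RingQuot.mkAlgHom_rel 𝕜 h

theorem a_mul_b : a hξ * b hξ = ξ • (b hξ * a hξ) := by
  simpa [a, b, c, d, gen] using proj_eq_of_rel (hξ := hξ) KRel.ab
theorem a_mul_c : a hξ * c hξ = ξ • (c hξ * a hξ) := by
  simpa [a, b, c, d, gen] using proj_eq_of_rel (hξ := hξ) KRel.ac
theorem c_mul_b : c hξ * b hξ = 0 := by
  simpa [a, b, c, d, gen] using proj_eq_of_rel (hξ := hξ) KRel.cb
theorem b_mul_c : b hξ * c hξ = 0 := by
  simpa [a, b, c, d, gen] using proj_eq_of_rel (hξ := hξ) KRel.bc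
theorem c_mul_d : c hξ * d hξ = ξ • (d hξ * c hξ) := by
  simpa [a, b, c, d, gen] using proj_eq_of_rel (hξ := hξ) KRel.cd
theorem b_mul_d : b hξ * d hξ = ξ • (d hξ * b hξ) := by
  simpa [a, b, c, d, gen] using proj_eq_of_rel (hξ := hξ) KRel.bd
theorem a_mul_d : a hξ * d hξ = 1 := by
  simpa [a, b, c, d, gen] using proj_eq_of_rel (hξ := hξ) KRel.ad
theorem d_mul_a : d hξ * a hξ = 1 := by
  have h := a_mul_d (hξ := hξ)
  rw [← h]
  simpa [a, b, c, d, gen] using (proj_eq_of_rel (hξ := hξ) KRel.ad_da).symm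
theorem b_mul_b : b hξ * b hξ = 0 := by
  simpa [a, b, c, d, gen, sq] using proj_eq_of_rel (hξ := hξ) KRel.bb
theorem c_mul_c : c hξ * c hξ = 0 := by
  simpa [a, b, c, d, gen, sq] using proj_eq_of_rel (hξ := hξ) KRel.cc
theorem a_sq_mul_c : a hξ ^ 2 * c hξ = b hξ := by
  simpa [a, b, c, d, gen] using proj_eq_of_rel (hξ := hξ) KRel.aac
theorem a_pow_four : a hξ ^ 4 = 1 := by
  simpa [a, b, c, d, gen] using proj_eq_of_rel (hξ := hξ) KRel.aaaa

theorem xi_mul_xi (hξ : IsPrimitiveRoot ξ 4) : ξ * ξ = -1 := by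
  have h4 := hξ.pow_eq_one
  have h2 : ξ ^ 2 ≠ 1 := hξ.pow_ne_one_of_pos_of_lt (by norm_num) (by norm_num)
  have : (ξ ^ 2 - 1) * (ξ ^ 2 + 1) = 0 := by linear_combination h4
  rcases mul_eq_zero.1 this with h | h
  · exact absurd (sub_eq_zero.1 h) h2
  · linear_combination h

/-- The relations of `K` for four elements of an algebra. -/
structure IsKTuple (ξ : 𝕜) {A : Type*} [Ring A] [Algebra 𝕜 A] (a b c d : A) : Prop where
  ab : a * b = ξ • (b * a)
  ac : a * c = ξ • (c * a)
  cb : c * b = 0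
  bc : b * c = 0
  cd : c * d = ξ • (d * c)
  bd : b * d = ξ • (d * b)
  ad_da : a * d = d * a
  ad : a * d = 1
  bb : b ^ 2 = 0
  cc : c ^ 2 = 0
  aac : a ^ 2 * c = b
  aaaa : a ^ 4 = 1

/-- The universal property of `K`. -/
def lift {A : Type*} [Ring A] [Algebra 𝕜 A] {a' b' c' d' : A} (h : IsKTuple ξ a' b' c' d') :
    KAlg hξ →ₐ[𝕜] A :=
  RingQuot.liftAlgHom 𝕜 ⟨FreeAlgebra.lift 𝕜 (fun i => KGen.casesOn i a' b' c' d'), by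
    intro x y hxy
    cases hxy <;> simp only [map_mul, map_pow, map_smul, map_one, map_zero, FreeAlgebra.lift_ι_apply]
    exacts [h.ab, h.ac, h.cb, h.bc, h.cd, h.bd, h.ad_da, h.ad, h.bb, h.cc, h.aac, h.aaaa]⟩

section lift
variable {A : Type*} [Ring A] [Algebra 𝕜 A] {a' b' c' d' : A} (h : IsKTuple ξ a' b' c' d')

theorem lift_gen (i : KGen) :
    lift (hξ := hξ) h (gen hξ i) = KGen.casesOn (motive := fun _ => A) i a' b' c' d' := by
  simp only [lift, gen, proj]
  erw [RingQuot.liftAlgHom_mkAlgHom_apply]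
  simp

@[simp] theorem lift_a : lift h (a hξ) = a' := lift_gen h _
@[simp] theorem lift_b : lift h (b hξ) = b' := lift_gen h _
@[simp] theorem lift_c : lift h (c hξ) = c' := lift_gen h _
@[simp] theorem lift_d : lift h (d hξ) = d' := lift_gen h _

theorem algHom_ext {B : Type*} [Semiring B] [Algebra 𝕜 B] {f g : KAlg hξ →ₐ[𝕜] B}
    (ha : f (a hξ) = g (a hξ)) (hb : f (b hξ) = g (b hξ))
    (hc : f (c hξ) = g (c hξ)) (hd : f (d hξ) = g (d hξ)) : f = g := by
  refine RingQuot.ringQuot_ext' 𝕜 f g (FreeAlgebra.hom_ext ?_)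
  funext i
  cases i
  exacts [ha, hb, hc, hd]

end lift

theorem adjoin_gens : Algebra.adjoin 𝕜 ({a hξ, b hξ, c hξ, d hξ} : Set (KAlg hξ)) = ⊤ := by
  set S := Algebra.adjoin 𝕜 ({a hξ, b hξ, c hξ, d hξ} : Set (KAlg hξ)) with hS
  have hmem : ∀ x ∈ ({a hξ, b hξ, c hξ, d hξ} : Set (KAlg hξ)), x ∈ S :=
    fun x hx => Algebra.subset_adjoin hx
  have hT : IsKTuple ξ (⟨a hξ, hmem _ (by simp)⟩ : S) ⟨b hξ, hmem _ (by simp)⟩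
      ⟨c hξ, hmem _ (by simp)⟩ ⟨d hξ, hmem _ (by simp)⟩ := by
    constructor <;> apply Subtype.ext <;> simp
    exacts [a_mul_b, a_mul_c, c_mul_b, b_mul_c, c_mul_d, b_mul_d, a_mul_d.trans d_mul_a.symm,
      a_mul_d, by rw [sq, b_mul_b], by rw [sq, c_mul_c], a_sq_mul_c, a_pow_four]
  have : S.val.comp (lift (hξ := hξ) hT) = AlgHom.id 𝕜 _ := by
    apply algHom_ext <;> simp
  rw [eq_top_iff]
  intro x _
  have hx := AlgHom.congr_fun this x
  rw [← show _ = x from hx]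
  exact (lift (hξ := hξ) hT x).2

theorem d_mul_b : d hξ * b hξ = ξ • (c hξ * a hξ) := by
  rw [← a_mul_c, ← a_sq_mul_c, sq, mul_assoc, ← mul_assoc, d_mul_a, one_mul]

theorem a_sq_mul_b : a hξ ^ 2 * b hξ = c hξ := by
  rw [← a_sq_mul_c, ← mul_assoc, ← pow_add, a_pow_four, one_mul]

theorem d_mul_c : d hξ * c hξ = ξ • (b hξ * a hξ) := by
  rw [← a_mul_b, ← a_sq_mul_b, sq, mul_assoc, ← mul_assoc, d_mul_a, one_mul]

theorem a_sq_mul_d : a hξ ^ 2 * d hξ = a hξ := by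
  rw [sq, mul_assoc, a_mul_d, mul_one]

theorem a_sq_mul_a : a hξ ^ 2 * a hξ = d hξ := by
  calc a hξ ^ 2 * a hξ = a hξ ^ 2 * a hξ * (a hξ * d hξ) := by rw [a_mul_d, mul_one]
    _ = a hξ ^ 4 * d hξ := by noncomm_ring
    _ = d hξ := by rw [a_pow_four, one_mul]

theorem comul_tuple_sq : (a hξ ⊗ₜ[𝕜] a hξ + b hξ ⊗ₜ[𝕜] c hξ) ^ 2 = (a hξ ^ 2) ⊗ₜ[𝕜] (a hξ ^ 2) := by
  have := xi_mul_xi hξ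
  rw [sq, sq]
  simp [add_mul, mul_add, a_mul_b, a_mul_c, b_mul_b, c_mul_c, ← TensorProduct.smul_tmul', smul_smul,
    xi_mul_xi hξ]

theorem comul_tuple : IsKTuple ξ (a hξ ⊗ₜ[𝕜] a hξ + b hξ ⊗ₜ[𝕜] c hξ)
    (a hξ ⊗ₜ[𝕜] b hξ + b hξ ⊗ₜ[𝕜] d hξ) (c hξ ⊗ₜ[𝕜] a hξ + d hξ ⊗ₜ[𝕜] c hξ)
    (c hξ ⊗ₜ[𝕜] b hξ + d hξ ⊗ₜ[𝕜] d hξ) := by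
  have := xi_mul_xi hξ
  constructor
  case aac =>
    rw [comul_tuple_sq]
    simp [mul_add, a_sq_mul_c, a_sq_mul_d, a_sq_mul_a, add_comm]
  case aaaa =>
    rw [show 4 = 2 * 2 from rfl, pow_mul, comul_tuple_sq, Algebra.TensorProduct.tmul_pow,
      ← pow_mul, a_pow_four, Algebra.TensorProduct.one_def]
  all_goals
    simp [sq, add_mul, mul_add, a_mul_b, a_mul_c, b_mul_b, c_mul_c, b_mul_c, c_mul_b, b_mul_d,
      c_mul_d, a_mul_d, d_mul_a, d_mul_b, d_mul_c, smul_smul,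
      ← TensorProduct.smul_tmul', TensorProduct.neg_tmul, TensorProduct.tmul_neg,
      xi_mul_xi hξ, Algebra.TensorProduct.one_def, add_comm]

theorem counit_tuple : IsKTuple ξ (1 : 𝕜) 0 0 1 := by
  constructor <;> simp

theorem d_pow_four : d hξ ^ 4 = 1 := by
  have h : a hξ ^ 4 * d hξ ^ 4 = 1 := by
    calc a hξ ^ 4 * d hξ ^ 4 =
        a hξ * (a hξ * (a hξ * (a hξ * d hξ) * d hξ) * d hξ) * d hξ := by noncomm_ring
      _ = 1 := by simp only [a_mul_d, mul_one]
  rwa [a_pow_four, one_mul] at h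

theorem antipode_tuple : IsKTuple ξ (MulOpposite.op (d hξ)) (MulOpposite.op (ξ • b hξ))
    (MulOpposite.op (-ξ • c hξ)) (MulOpposite.op (a hξ)) := by
  have hx := xi_mul_xi hξ
  constructor <;> apply MulOpposite.unop_injective
  case aac => simp [sq, c_mul_d, smul_smul, hx, mul_assoc, d_mul_c, a_mul_d]
  case aaaa => simp [d_pow_four]
  all_goals
    simp [sq, b_mul_b, c_mul_c, b_mul_c, c_mul_b, b_mul_d, c_mul_d, a_mul_d, a_mul_b, a_mul_c,
      d_mul_a, smul_smul, hx]

/-- The bialgebra structure of `K`: `Δ(a) = a ⊗ a + b ⊗ c`, `Δ(b) = a ⊗ b + b ⊗ d`,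
`Δ(c) = c ⊗ a + d ⊗ c`, `Δ(d) = c ⊗ b + d ⊗ d`, `ε(a) = ε(d) = 1`, `ε(b) = ε(c) = 0`. -/
instance : Bialgebra 𝕜 (KAlg hξ) :=
  Bialgebra.ofAlgHom (lift comul_tuple) (lift counit_tuple)
    (by
      apply algHom_ext <;> simp [TensorProduct.add_tmul, TensorProduct.tmul_add] <;> abel)
    (by apply algHom_ext <;> simp)
    (by apply algHom_ext <;> simp)

theorem comul_eq (x : KAlg hξ) : Coalgebra.comul (R := 𝕜) x = lift (hξ := hξ) comul_tuple x := rfl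
theorem counit_eq (x : KAlg hξ) : Coalgebra.counit (R := 𝕜) x = lift (hξ := hξ) counit_tuple x :=
  rfl

/-- The antipode of `K`: the anti-homomorphism with `S(a) = d`, `S(b) = ξ b`, `S(c) = -ξ c`,
`S(d) = a`. -/
def antipodeOp : KAlg hξ →ₐ[𝕜] (KAlg hξ)ᵐᵒᵖ := lift antipode_tuple

instance : HopfAlgebra 𝕜 (KAlg hξ) where
  antipode := (MulOpposite.opLinearEquiv 𝕜).symm.toLinearMap ∘ₗ (antipodeOp (hξ := hξ)).toLinearMap
  mul_antipode_rTensor_comul := by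
    refine LinearMap.ext (antipode_left_of_generators _ _ adjoin_gens ?_)
    have hx := xi_mul_xi hξ
    rintro x (rfl | rfl | rfl | rfl) <;>
      simp [comul_eq, counit_eq, antipodeOp, a_mul_c, b_mul_c, c_mul_b, b_mul_d, a_mul_d, d_mul_a,
        d_mul_b, smul_smul, hx]
  mul_antipode_lTensor_comul := by
    refine LinearMap.ext (antipode_right_of_generators _ _ adjoin_gens ?_)
    have hx := xi_mul_xi hξ
    rintro x (rfl | rfl | rfl | rfl) <;>
      simp [comul_eq, counit_eq, antipodeOp, a_mul_b, b_mul_c, c_mul_b, c_mul_d, a_mul_d, d_mul_a,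
        d_mul_c, smul_smul, hx]

theorem antipode_eq (x : KAlg hξ) : HopfAlgebra.antipode 𝕜 x = (antipodeOp x).unop := rfl

/-- `S²` as an algebra map. -/
def antipodeSq : KAlg hξ →ₐ[𝕜] KAlg hξ :=
  AlgHom.ofLinearMap (HopfAlgebra.antipode 𝕜 ∘ₗ HopfAlgebra.antipode 𝕜)
    (by simp) (fun x y => by simp [HopfAlgebra.antipode_mul_antidistrib])

theorem antipodeSq_apply (x : KAlg hξ) :
    antipodeSq x = HopfAlgebra.antipode 𝕜 (HopfAlgebra.antipode 𝕜 x) := rfl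

theorem antipodeSq_antipodeSq (x : KAlg hξ) : antipodeSq (antipodeSq x) = x := by
  have h : (antipodeSq (hξ := hξ)).comp antipodeSq = AlgHom.id 𝕜 _ := by
    have hx := xi_mul_xi hξ
    apply algHom_ext <;>
      simp [antipodeSq_apply, antipode_eq, antipodeOp, smul_smul, hx]
  exact AlgHom.congr_fun h x

theorem antipode_bijective : Function.Bijective (HopfAlgebra.antipode 𝕜 (A := KAlg hξ)) := by
  constructor
  · intro x y hxy
    rw [← antipodeSq_antipodeSq x, ← antipodeSq_antipodeSq y]
    simp only [antipodeSq_apply, hxy]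
  · intro x
    exact ⟨_, antipodeSq_antipodeSq x⟩

theorem alpha_tuple (hξ : IsPrimitiveRoot ξ 4) : IsKTuple ξ ξ⁻¹ 0 0 ξ := by
  have h0 : ξ ≠ 0 := hξ.ne_zero (by norm_num)
  constructor <;> simp [h0, hξ.pow_eq_one]

/-- The algebra map `α₁ : K → 𝕜`. -/
def alpha (hξ : IsPrimitiveRoot ξ 4) : KAlg hξ →ₐ[𝕜] 𝕜 := lift (alpha_tuple hξ)

theorem skew_tuple (hξ : IsPrimitiveRoot ξ 4) (t : 𝕜) :
    IsKTuple ξ (!![1, 0; 0, ξ⁻¹] : Matrix (Fin 2) (Fin 2) 𝕜) !![0, t; 0, 0] !![0, t; 0, 0]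
      !![1, 0; 0, ξ] := by
  have h0 : ξ ≠ 0 := hξ.ne_zero (by norm_num)
  have hx := xi_mul_xi hξ
  have h5 : ξ * ξ * ξ * ξ = 1 := by rw [hx]; simp [hx]
  have h6 : ξ⁻¹ = -ξ := by
    field_simp
    linear_combination hx
  constructor <;> ext i j <;> fin_cases i <;> fin_cases j <;>
    simp [pow_succ, Matrix.mul_apply, Fin.sum_univ_two, h0]
  · rw [h6]; linear_combination t * hx
  · rw [h6]; linear_combination t * hx
  · ring
  · ring
  · rw [h6]; linear_combination h5

/-- The matrix representation `u ↦ !![ε(u), x(u); 0, α₁(u)]` of `K`, where `x` is the linear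
functional with `x(u v) = ε(u) x(v) + x(u) α₁(v)`, `x(a) = x(d) = 0` and `x(b) = x(c) = t`. -/
def skewRep (hξ : IsPrimitiveRoot ξ 4) (t : 𝕜) : KAlg hξ →ₐ[𝕜] Matrix (Fin 2) (Fin 2) 𝕜 :=
  lift (skew_tuple hξ t)

/-- The linear functional on `K` with value `s ξ` on `b, c, ab, ac` and `0` on `1, a, d, a²`. -/
def skewPrim (hξ : IsPrimitiveRoot ξ 4) (s : 𝕜) : KAlg hξ →ₗ[𝕜] 𝕜 :=
  Matrix.entryLinearMap 𝕜 𝕜 0 1 ∘ₗ (skewRep hξ (s * ξ)).toLinearMap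

theorem skewPrim_values (hξ : IsPrimitiveRoot ξ 4) (s : 𝕜) :
    skewPrim hξ s 1 = 0 ∧ skewPrim hξ s (a hξ) = 0 ∧ skewPrim hξ s (b hξ) = s * ξ ∧
      skewPrim hξ s (c hξ) = s * ξ ∧ skewPrim hξ s (d hξ) = 0 ∧ skewPrim hξ s (a hξ ^ 2) = 0 ∧
      skewPrim hξ s (a hξ * b hξ) = s * ξ ∧ skewPrim hξ s (a hξ * c hξ) = s * ξ := by
  simp [skewPrim, skewRep, sq]

instance : HasBijectiveAntipode 𝕜 (KAlg hξ) := ⟨antipode_bijective⟩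

end KAlg

/-- The Drinfeld double `D = D(K^cop)`. -/
abbrev DK {𝕜 : Type*} [Field 𝕜] {ξ : 𝕜} (hξ : IsPrimitiveRoot ξ 4) : Type _ :=
  DrinfeldDouble 𝕜 (Cop 𝕜 (KAlg hξ))

namespace DK

/-- The element `ε ⋈ u` of `D`, for `u : K`. -/
def ofK (u : KAlg hξ) : DK hξ := bowtie 𝕜 (Cop 𝕜 (KAlg hξ)) 1 (toCop 𝕜 (KAlg hξ) u)

/-- The element `f ⋈ 1` of `D`, for a linear functional `f` on `K`. -/
def ofDual (f : KAlg hξ →ₗ[𝕜] 𝕜) : DK hξ :=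
  bowtie 𝕜 (Cop 𝕜 (KAlg hξ)) (toConv (f ∘ₗ (toCop 𝕜 (KAlg hξ)).symm.toLinearMap)) 1

def a : DK hξ := ofK hξ (KAlg.a hξ)
def b : DK hξ := ofK hξ (KAlg.b hξ)
def c : DK hξ := ofK hξ (KAlg.c hξ)
def d : DK hξ := ofK hξ (KAlg.d hξ)

/-- The element `g = α₁ ⋈ 1` of `D`. -/
def g : DK hξ := ofDual hξ (KAlg.alpha hξ).toLinearMap

/-- The element `x = s ξ (b* + c* + (ab)* + (ac)*) ⋈ 1` of `D`, where `s² = 2`. -/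
def x (s : 𝕜) : DK hξ := ofDual hξ (KAlg.skewPrim hξ s)

end DK
end KAlgebra

section Modules

/-- The left `A`-module with underlying space `V` given by a representation of `A` on `V`. -/
def RepModule {𝕜 A V : Type*} [Field 𝕜] [Ring A] [Algebra 𝕜 A] [AddCommGroup V] [Module 𝕜 V]
    (_φ : A →ₐ[𝕜] Module.End 𝕜 V) : Type _ := V

variable {𝕜 A V : Type*} [Field 𝕜] [Ring A] [Algebra 𝕜 A] [AddCommGroup V] [Module 𝕜 V]

instance (φ : A →ₐ[𝕜] Module.End 𝕜 V) : AddCommGroup (RepModule φ) :=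
  inferInstanceAs (AddCommGroup V)

instance (φ : A →ₐ[𝕜] Module.End 𝕜 V) : Module 𝕜 (RepModule φ) :=
  inferInstanceAs (Module 𝕜 V)

instance (φ : A →ₐ[𝕜] Module.End 𝕜 V) : Module A (RepModule φ) :=
  Module.compHom V φ.toRingHom

theorem RepModule.smul_def (φ : A →ₐ[𝕜] Module.End 𝕜 V) (x : A) (v : RepModule φ) :
    x • v = (φ x : V →ₗ[𝕜] V) v := rfl

instance (φ : A →ₐ[𝕜] Module.End 𝕜 V) : IsScalarTower 𝕜 A (RepModule φ) where
  smul_assoc r x v := by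
    rw [RepModule.smul_def, RepModule.smul_def, map_smul]
    rfl

/-- The one-dimensional module `𝕜_χ` of a character `χ`. -/
abbrev CharModule (χ : A →ₐ[𝕜] 𝕜) : Type _ := RepModule ((Algebra.lmul 𝕜 𝕜).comp χ)

/-- The module of column vectors of a matrix representation `ρ`. -/
abbrev MatModule {n : ℕ} (ρ : A →ₐ[𝕜] Matrix (Fin n) (Fin n) 𝕜) : Type _ :=
  RepModule ((Matrix.toLinAlgEquiv' (R := 𝕜) (n := Fin n)).toAlgHom.comp ρ)

end Modules

section Statement

/-- The index set `Λ = {(i, j) ∈ ℤ/4 × ℤ/4 : 2 i ≠ j}`. -/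
abbrev Lam : Type := {p : ZMod 4 × ZMod 4 // 2 * p.1 ≠ p.2}

variable {𝕜 : Type*} [Field 𝕜] {ξ : 𝕜}

/-- `ξ ^ n` for an exponent `n` modulo `4`. -/
def xiPow (ξ : 𝕜) (n : ZMod 4) : 𝕜 := ξ ^ n.val

/-- The values of the character `χ^j` on the generators of `D`. -/
structure HasCharValues (hξ : IsPrimitiveRoot ξ 4) (s : 𝕜) (j : ZMod 4) (χ : DK hξ →ₐ[𝕜] 𝕜) :
    Prop where
  a : χ (DK.a hξ) = xiPow ξ j
  b : χ (DK.b hξ) = 0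
  c : χ (DK.c hξ) = 0
  d : χ (DK.d hξ) = xiPow ξ (-j)
  x : χ (DK.x hξ s) = 0
  g : χ (DK.g hξ) = (-1) ^ j.val

/-- The matrices of the generators of `D` on the module `V_{i,j}`. -/
structure HasMatrixValues (hξ : IsPrimitiveRoot ξ 4) (s : 𝕜) (i j : ZMod 4)
    (ρ : DK hξ →ₐ[𝕜] Matrix (Fin 2) (Fin 2) 𝕜) : Prop where
  a : ρ (DK.a hξ) = !![xiPow ξ i, 0; 0, xiPow ξ (i + 3)]
  b : ρ (DK.b hξ) = !![0, (-1) ^ i.val; 0, 0]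
  c : ρ (DK.c hξ) = !![0, 1; 0, 0]
  d : ρ (DK.d hξ) = !![xiPow ξ (-i), 0; 0, xiPow ξ (-i + 1)]
  g : ρ (DK.g hξ) = !![xiPow ξ j, 0; 0, xiPow ξ (j + 2)]
  x : ρ (DK.x hξ s) = !![0, s / 2 * ξ * (xiPow ξ i + xiPow ξ (3 * i + j));
    s * ξ * (xiPow ξ (3 * i) - xiPow ξ (i + j)), 0]

/-- The modules `𝕜_{χ^j}` (for `j ∈ ℤ/4`) and `V_{i,j}` (for `(i, j) ∈ Λ`) as a single family. -/
def simpleFamily {𝕜 : Type u} [Field 𝕜] {ξ : 𝕜} (hξ : IsPrimitiveRoot ξ 4)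
    (χ : ZMod 4 → (DK hξ →ₐ[𝕜] 𝕜)) (ρ : Lam → (DK hξ →ₐ[𝕜] Matrix (Fin 2) (Fin 2) 𝕜)) :
    ZMod 4 ⊕ Lam → ModuleCat.{u} (DK hξ)
  | .inl j => ModuleCat.of (DK hξ) (CharModule (χ j))
  | .inr p => ModuleCat.of (DK hξ) (MatModule (ρ p))

end Statement

end

/-!
The double `D` is generated by `a, c` (from `K`) and `g, x` (from the dual of `K`). The algebras `K`
and its dual have bases of monomials `aᵏ, c aᵏ` and `gᵏ, x gᵏ`, so `D` is presented by the relations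
within each pair and by four relations moving `a, c` past `g, x`. Hence an algebra map out of `D` is
the same thing as a quadruple satisfying these relations, which yields the characters and the matrix
representations.

Let `M` be a `D`-module. The element `c` acts nilpotently, and on its kernel `a` and `g` commute and
satisfy `T⁴ = 1`; since all fourth roots of unity lie in the field, `M ≠ 0` contains a highest
weight vector `v`: `c v = 0`, `a v = ξⁱ v`, `g v = ξʲ v`. The relations show that `span {v, x v}` is
stable under `D`. If `M` is simple then `x v = 0` when `2 i = j`, while otherwise `c x v` is a
nonzero multiple of `v`; so the line of `v` is the kernel of `c`, and the annihilator of `v`, hence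
`M`, depends on `(i, j)` only. Each of the sixteen weights occurs exactly once in the list:
`𝕜_{χ^j}` has highest weight `(j, 2 j)` and `V_{i,j}` has highest weight `(i, j)`.
-/

noncomputable section

section Generation

variable {𝕜 A B : Type*} [CommSemiring 𝕜] [Semiring A] [Algebra 𝕜 A] [Semiring B] [Algebra 𝕜 B]
  {T : Set A}

theorem forall_of_adjoin_eq_top (hT : Algebra.adjoin 𝕜 T = ⊤) {p : A → Prop}
    (mem : ∀ t ∈ T, p t) (algebraMap : ∀ r, p (algebraMap 𝕜 A r))
    (add : ∀ x y, p x → p y → p (x + y)) (mul : ∀ x y, p x → p y → p (x * y)) (z : A) : p z :=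
  Algebra.adjoin_induction mem algebraMap (fun x y _ _ => add x y) (fun x y _ _ => mul x y)
    (hT ▸ Algebra.mem_top : z ∈ Algebra.adjoin 𝕜 T)

theorem smul_mem_of_adjoin_eq_top {M : Type*} [AddCommMonoid M] [Module 𝕜 M] [Module A M]
    [IsScalarTower 𝕜 A M] (hT : Algebra.adjoin 𝕜 T = ⊤) {S : Submodule 𝕜 M}
    (smul_mem : ∀ t ∈ T, ∀ w ∈ S, t • w ∈ S) (z : A) : ∀ w ∈ S, z • w ∈ S :=
  forall_of_adjoin_eq_top (p := fun z => ∀ w ∈ S, z • w ∈ S) hT smul_mem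
    (fun r w hw => by rw [algebraMap_smul]; exact S.smul_mem r hw)
    (fun x y hx hy w hw => by rw [add_smul]; exact S.add_mem (hx w hw) (hy w hw))
    (fun x y hx hy w hw => by rw [mul_smul]; exact hx _ (hy w hw)) z

theorem submodule_eq_top_of_adjoin_eq_top (hT : Algebra.adjoin 𝕜 T = ⊤) {S : Submodule 𝕜 A}
    (one_mem : 1 ∈ S) (mul_mem : ∀ t ∈ T, ∀ z ∈ S, t * z ∈ S) : S = ⊤ :=
  eq_top_iff.2 fun y _ => mul_one y ▸ smul_mem_of_adjoin_eq_top hT mul_mem y 1 one_mem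

/-- A unital linear map which is multiplicative in a first factor taken from a generating set, as
an algebra map. -/
def algHomOfAdjoinEqTop (hT : Algebra.adjoin 𝕜 T = ⊤) (L : A →ₗ[𝕜] B) (one : L 1 = 1)
    (mul : ∀ t ∈ T, ∀ z, L (t * z) = L t * L z) : A →ₐ[𝕜] B :=
  AlgHom.ofLinearMap L one <| forall_of_adjoin_eq_top hT mul
    (fun r z => by simp [Algebra.algebraMap_eq_smul_one, one])
    (fun x y hx hy z => by simp only [add_mul, map_add, hx, hy])
    (fun x y hx hy z => by rw [mul_assoc, hx, hx, hy, mul_assoc])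

end Generation

theorem eq_zero_of_twisted_leibniz {𝕜 A B : Type*} [CommRing 𝕜] [Ring A] [Algebra 𝕜 A] [Ring B]
    [Algebra 𝕜 B] {T : Set A} (hT : Algebra.adjoin 𝕜 T = ⊤) (σ τ : A →ₐ[𝕜] B) {L : A →ₗ[𝕜] B}
    (leibniz : ∀ u v, L (u * v) = σ u * L v + L u * τ v) (hL : ∀ t ∈ T, L t = 0) : L = 0 := by
  have one : L 1 = 0 := by simpa using leibniz 1 1
  refine LinearMap.ext (forall_of_adjoin_eq_top hT hL (fun r => ?_) (fun u v hu hv => ?_)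
    fun u v hu hv => ?_)
  · rw [Algebra.algebraMap_eq_smul_one, map_smul, one, smul_zero, LinearMap.zero_apply]
  · simp only [map_add, hu, hv]
  · simp only [leibniz, hu, hv, LinearMap.zero_apply, mul_zero, zero_mul, add_zero]

theorem linearIndependent_of_isUnit_pairing {𝕜 M N ι : Type*} [CommRing 𝕜] [AddCommGroup M]
    [Module 𝕜 M] [AddCommGroup N] [Module 𝕜 N] [Fintype ι] [DecidableEq ι]
    (P : M →ₗ[𝕜] N →ₗ[𝕜] 𝕜) {v : ι → M} {w : ι → N}
    (h : IsUnit (Matrix.of fun i j => P (v i) (w j))) : LinearIndependent 𝕜 v :=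
  .of_comp (LinearMap.pi fun j => P.flip (w j)) (Matrix.linearIndependent_rows_of_isUnit h)

theorem isSimpleModule_of_forall_exists_smul_eq {R M : Type*} [Ring R] [AddCommGroup M]
    [Module R M] {v : M} (hv : v ≠ 0) (span : ∀ w : M, ∃ r : R, r • v = w)
    (mem : ∀ w : M, w ≠ 0 → ∃ r : R, r • w = v) : IsSimpleModule R M where
  exists_pair_ne := ⟨⊥, ⊤, fun h => hv ((Submodule.mem_bot R).1 (h ▸ Submodule.mem_top))⟩
  eq_bot_or_eq_top N := or_iff_not_imp_left.2 fun hN => by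
    obtain ⟨w, hw, hw0⟩ := N.ne_bot_iff.1 hN
    obtain ⟨r, hr⟩ := mem w hw0
    refine eq_top_iff.2 fun u _ => ?_
    obtain ⟨t, rfl⟩ := span u
    exact N.smul_mem t (hr ▸ N.smul_mem r hw)

theorem nonempty_linearEquiv_of_smul_eq_zero_iff {R M N : Type*} [Ring R] [AddCommGroup M]
    [Module R M] [IsSimpleModule R M] [AddCommGroup N] [Module R N] [IsSimpleModule R N]
    {v : M} {w : N} (hv : v ≠ 0) (hw : w ≠ 0) (h : ∀ r : R, r • v = 0 ↔ r • w = 0) :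
    Nonempty (M ≃ₗ[R] N) := by
  have ker_eq : LinearMap.ker (LinearMap.toSpanSingleton R M v) =
      LinearMap.ker (LinearMap.toSpanSingleton R N w) := Submodule.ext h
  have surj_v := IsSimpleModule.toSpanSingleton_surjective R hv
  have surj_w := IsSimpleModule.toSpanSingleton_surjective R hw
  exact ⟨(LinearMap.quotKerEquivOfSurjective _ surj_v).symm ≪≫ₗ
    Submodule.quotEquivOfEq _ _ ker_eq ≪≫ₗ LinearMap.quotKerEquivOfSurjective _ surj_w⟩

/-- A unit `z` with `z⁴ = 1` and an element `y` which is normalised by `z` and squares to a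
multiple of `z² - 1`. This is the shape of the generators `a, c` of `K` and of the generators
`g, x` of its dual. -/
structure IsSkewPair {𝕜 B : Type*} [CommRing 𝕜] [Ring B] [Algebra 𝕜 B] (r p : 𝕜) (z y : B) :
    Prop where
  pow_four : z ^ 4 = 1
  mul_comm : z * y = r • (y * z)
  mul_self : y * y = p • (z * z - 1)

namespace IsSkewPair

variable {𝕜 B : Type*} [CommRing 𝕜] [Ring B] [Algebra 𝕜 B] {r p : 𝕜} {z y : B}

/-- The family of the `zᵏ` and the `y zᵏ`, for `k < 4`. -/
def monomials (z y : B) : Fin 4 ⊕ Fin 4 → B :=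
  Sum.elim (fun k => z ^ k.val) (fun k => y * z ^ k.val)

theorem monomials_zero : monomials z y (.inl 0) = 1 := pow_zero z

theorem pow_val_add (h : IsSkewPair r p z y) (k l : Fin 4) :
    z ^ (k + l).val = z ^ k.val * z ^ l.val := by
  rw [← pow_add, Fin.val_add, ← pow_eq_pow_mod _ h.pow_four]

theorem mul_monomials_inl (h : IsSkewPair r p z y) (k : Fin 4) :
    z * monomials z y (.inl k) = monomials z y (.inl (1 + k)) := by
  simp [monomials, h.pow_val_add]

theorem mul_monomials_inr (h : IsSkewPair r p z y) (k : Fin 4) :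
    z * monomials z y (.inr k) = r • monomials z y (.inr (1 + k)) := by
  simp [monomials, h.pow_val_add, ← mul_assoc, h.mul_comm]

theorem skew_mul_monomials_inl (k : Fin 4) :
    y * monomials z y (.inl k) = monomials z y (.inr k) := rfl

theorem skew_mul_monomials_inr (h : IsSkewPair r p z y) (k : Fin 4) :
    y * monomials z y (.inr k) =
      p • (monomials z y (.inl (2 + k)) - monomials z y (.inl k)) := by
  simp [monomials, h.pow_val_add, ← mul_assoc, h.mul_self, sub_mul, sq]

theorem span_monomials (h : IsSkewPair r p z y) (hzy : Algebra.adjoin 𝕜 {z, y} = ⊤) :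
    Submodule.span 𝕜 (Set.range (monomials z y)) = ⊤ := by
  set S := Submodule.span 𝕜 (Set.range (monomials z y))
  have mem (i) : monomials z y i ∈ S := Submodule.subset_span ⟨i, rfl⟩
  have closed {t : B} (ht : ∀ i, t * monomials z y i ∈ S) : ∀ w ∈ S, t * w ∈ S :=
    (Submodule.span_le (p := S.comap (LinearMap.mulLeft 𝕜 t))).2 (Set.range_subset_iff.2 ht)
  refine submodule_eq_top_of_adjoin_eq_top hzy (monomials_zero (y := y) ▸ mem _) ?_
  rintro t (rfl | rfl)
  · refine closed ?_
    rintro (k | k)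
    · exact h.mul_monomials_inl k ▸ mem _
    · exact h.mul_monomials_inr k ▸ S.smul_mem r (mem _)
  · refine closed ?_
    rintro (k | k)
    · exact mem (.inr k)
    · exact h.skew_mul_monomials_inr k ▸ S.smul_mem p (S.sub_mem (mem _) (mem _))

theorem adjoin_eq_top_of_span_monomials
    (h : Submodule.span 𝕜 (Set.range (monomials z y)) = ⊤) : Algebra.adjoin 𝕜 {z, y} = ⊤ := by
  have hz : z ∈ Algebra.adjoin 𝕜 {z, y} := Algebra.subset_adjoin (.inl rfl)
  have hy : y ∈ Algebra.adjoin 𝕜 {z, y} := Algebra.subset_adjoin (.inr rfl)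
  refine Algebra.toSubmodule_eq_top.1 (eq_top_iff.2 (h ▸ Submodule.span_le.2 ?_))
  rintro _ ⟨k | k, rfl⟩
  · exact Subalgebra.pow_mem _ hz _
  · exact Subalgebra.mul_mem _ hy (Subalgebra.pow_mem _ hz _)

section lift

variable {A : Type*} [Ring A] [Algebra 𝕜 A] {z' y' : A}
  (bas : Module.Basis (Fin 4 ⊕ Fin 4) 𝕜 B) (hbas : ⇑bas = monomials z y)

include hbas in
theorem constr_monomials (i : Fin 4 ⊕ Fin 4) :
    bas.constr 𝕜 (monomials z' y') (monomials z y i) = monomials z' y' i := by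
  rw [← hbas, bas.constr_basis]

include hbas in
theorem constr_mul (h : IsSkewPair r p z y) (h' : IsSkewPair r p z' y') (w : B) :
    bas.constr 𝕜 (monomials z' y') (z * w) = z' * bas.constr 𝕜 (monomials z' y') w := by
  have hL := constr_monomials (z' := z') (y' := y') bas hbas
  generalize bas.constr 𝕜 (monomials z' y') = L at hL ⊢
  suffices L ∘ₗ LinearMap.mulLeft 𝕜 z = LinearMap.mulLeft 𝕜 z' ∘ₗ L from LinearMap.congr_fun this w
  refine bas.ext ?_
  rw [hbas]
  rintro (k | k) <;> simp only [LinearMap.comp_apply, LinearMap.mulLeft_apply]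
  · rw [h.mul_monomials_inl, hL, hL, h'.mul_monomials_inl]
  · rw [h.mul_monomials_inr, map_smul, hL, hL, h'.mul_monomials_inr]

include hbas in
theorem constr_skew_mul (h : IsSkewPair r p z y) (h' : IsSkewPair r p z' y') (w : B) :
    bas.constr 𝕜 (monomials z' y') (y * w) = y' * bas.constr 𝕜 (monomials z' y') w := by
  have hL := constr_monomials (z' := z') (y' := y') bas hbas
  generalize bas.constr 𝕜 (monomials z' y') = L at hL ⊢
  suffices L ∘ₗ LinearMap.mulLeft 𝕜 y = LinearMap.mulLeft 𝕜 y' ∘ₗ L from LinearMap.congr_fun this w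
  refine bas.ext ?_
  rw [hbas]
  rintro (k | k) <;> simp only [LinearMap.comp_apply, LinearMap.mulLeft_apply]
  · rw [skew_mul_monomials_inl, hL, hL, skew_mul_monomials_inl]
  · rw [h.skew_mul_monomials_inr, map_smul, map_sub, hL, hL, hL, h'.skew_mul_monomials_inr]

include hbas in
theorem constr_one : bas.constr 𝕜 (monomials z' y') 1 = 1 := by
  rw [← monomials_zero (z := z) (y := y), constr_monomials bas hbas, monomials_zero]

include hbas in
theorem constr_fst (h : IsSkewPair r p z y) (h' : IsSkewPair r p z' y') :
    bas.constr 𝕜 (monomials z' y') z = z' := by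
  rw [← mul_one z, constr_mul bas hbas h h', constr_one bas hbas, mul_one]

include hbas in
theorem constr_snd (h : IsSkewPair r p z y) (h' : IsSkewPair r p z' y') :
    bas.constr 𝕜 (monomials z' y') y = y' := by
  rw [← mul_one y, constr_skew_mul bas hbas h h', constr_one bas hbas, mul_one]

variable (h : IsSkewPair r p z y) (h' : IsSkewPair r p z' y') (hzy : Algebra.adjoin 𝕜 {z, y} = ⊤)

/-- The algebra map sending a skew pair whose monomials form a basis to another skew pair. -/
def lift : B →ₐ[𝕜] A :=
  algHomOfAdjoinEqTop hzy (bas.constr 𝕜 (monomials z' y')) (constr_one bas hbas) <| by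
    rintro t (rfl | rfl) w
    · rw [constr_mul bas hbas h h', constr_fst bas hbas h h']
    · rw [constr_skew_mul bas hbas h h', constr_snd bas hbas h h']

theorem lift_fst : lift bas hbas h h' hzy z = z' := constr_fst bas hbas h h'

theorem lift_snd : lift bas hbas h h' hzy y = y' := constr_snd bas hbas h h'

end lift

end IsSkewPair

section Contraction

open Coalgebra

variable {𝕜 H : Type*} [Field 𝕜] [Ring H]

section Bialgebra

variable [Bialgebra 𝕜 H]

/-- The contraction `u ↦ f(u₁) u₂` of the comultiplication with a functional `f`. -/
def contract : (H →ₗ[𝕜] 𝕜) →ₗ[𝕜] H →ₗ[𝕜] H where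
  toFun f := (TensorProduct.lid 𝕜 H).toLinearMap ∘ₗ f.rTensor H ∘ₗ comul
  map_add' f f' := by ext u; simp [LinearMap.rTensor_add]
  map_smul' r f := by ext u; simp [LinearMap.rTensor_smul]

theorem contract_apply (f : H →ₗ[𝕜] 𝕜) (u : H) :
    contract f u = TensorProduct.lid 𝕜 H (f.rTensor H (comul u)) := rfl

theorem contract_counit : contract (counit (R := 𝕜) (A := H)) = LinearMap.id :=
  LinearMap.ext fun u => by
    rw [contract_apply, rTensor_counit_comul, TensorProduct.lid_tmul, one_smul, LinearMap.id_apply]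

theorem counit_contract (f : H →ₗ[𝕜] 𝕜) (u : H) : counit (R := 𝕜) (contract f u) = f u := by
  have h : counit ∘ₗ (TensorProduct.lid 𝕜 H).toLinearMap ∘ₗ f.rTensor H =
      f ∘ₗ (TensorProduct.rid 𝕜 H).toLinearMap ∘ₗ counit.lTensor H := by
    ext; simp [mul_comm]
  simpa [contract_apply] using LinearMap.congr_fun h (comul u)

theorem contract_mul_of_leibniz {σ τ f : H →ₗ[𝕜] 𝕜}
    (leibniz : ∀ u v, f (u * v) = σ u * f v + f u * τ v) (u v : H) :
    contract f (u * v) = contract σ u * contract f v + contract f u * contract τ v := by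
  simp only [contract_apply, Bialgebra.comul_mul]
  generalize comul (R := 𝕜) u = z
  generalize comul (R := 𝕜) v = w
  induction z with
  | zero => simp
  | add z z' hz hz' => simp only [add_mul, map_add, hz, hz']; abel
  | tmul p p' =>
    induction w with
    | zero => simp
    | add w w' hw hw' => simp only [mul_add, map_add, hw, hw']; abel
    | tmul q q' => simp [leibniz, add_smul, smul_smul, mul_comm]

/-- The contraction of the comultiplication with a character, as an algebra map. -/
def contractAlgHom (χ : H →ₐ[𝕜] 𝕜) : H →ₐ[𝕜] H :=
  (Algebra.TensorProduct.lid 𝕜 H).toAlgHom.comp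
    ((Algebra.TensorProduct.map χ (.id 𝕜 H)).comp (Bialgebra.comulAlgHom 𝕜 H))

theorem contract_toLinearMap (χ : H →ₐ[𝕜] 𝕜) (u : H) :
    contract χ.toLinearMap u = contractAlgHom χ u := rfl

end Bialgebra

section Hopf

variable [HopfAlgebra 𝕜 H] [HasBijectiveAntipode 𝕜 H]

/-- Evaluation identifies the elements of the dual algebra of `H^cop` with the functionals on
`H`. -/
def ev : DualAlg 𝕜 (Cop 𝕜 H) ≃ₗ[𝕜] (H →ₗ[𝕜] 𝕜) :=
  (WithConv.linearEquiv 𝕜 _).trans ((toCop 𝕜 H).symm.toLinearEquiv.arrowCongr (.refl 𝕜 𝕜))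

theorem ev_one : ev (1 : DualAlg 𝕜 (Cop 𝕜 H)) = counit := rfl

theorem ev_mul (f f' : DualAlg 𝕜 (Cop 𝕜 H)) (u : H) :
    ev (f * f') u = ev f (contract (ev f') u) := by
  change LinearMap.mul' 𝕜 𝕜 (TensorProduct.map (ev f) (ev f')
    (TensorProduct.comm 𝕜 _ _ (comul (R := 𝕜) u))) = _
  have h : LinearMap.mul' 𝕜 𝕜 ∘ₗ TensorProduct.map (ev f) (ev f') ∘ₗ TensorProduct.comm 𝕜 H H =
      ev f ∘ₗ TensorProduct.lid 𝕜 H ∘ₗ (ev f').rTensor H := by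
    ext; simp [mul_comm]
  exact LinearMap.congr_fun h (comul u)

theorem contract_ev_mul (f f' : DualAlg 𝕜 (Cop 𝕜 H)) :
    contract (ev (f * f')) = contract (ev f) ∘ₗ contract (ev f') := by
  refine LinearMap.ext fun u => sub_eq_zero.1 <|
    (Module.forall_dual_apply_eq_zero_iff 𝕜 _).1 fun l => ?_
  obtain ⟨h, rfl⟩ := (ev (H := H)).surjective l
  rw [map_sub, sub_eq_zero, LinearMap.comp_apply, ← ev_mul, ← ev_mul, ← ev_mul, mul_assoc]

variable (𝕜 H) in
/-- The action of the dual algebra of `H^cop` on `H` by contraction. -/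
def coregular : DualAlg 𝕜 (Cop 𝕜 H) →ₐ[𝕜] Module.End 𝕜 H :=
  AlgHom.ofLinearMap (contract ∘ₗ ev.toLinearMap) (contract_counit (H := H)) contract_ev_mul

theorem coregular_apply (f : DualAlg 𝕜 (Cop 𝕜 H)) : coregular 𝕜 H f = contract (ev f) := rfl

theorem coregular_injective : Function.Injective (coregular 𝕜 H) :=
  fun f f' h => ev.injective <| LinearMap.ext fun u => by
    rw [← counit_contract, ← counit_contract (ev f'), ← coregular_apply, h, coregular_apply]

end Hopf

end Contraction

section PrimitiveFourthRoot

variable {𝕜 : Type*} [Field 𝕜] {ξ : 𝕜}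

theorem two_ne_zero_of_isPrimitiveRoot_four (hξ : IsPrimitiveRoot ξ 4) : (2 : 𝕜) ≠ 0 := by
  have := hξ.neZero'
  intro h
  exact NeZero.ne ((4 : ℕ) : 𝕜) (by linear_combination 2 * h)

theorem inv_eq_neg_of_isPrimitiveRoot_four (hξ : IsPrimitiveRoot ξ 4) : ξ⁻¹ = -ξ :=
  inv_eq_of_mul_eq_one_right (by rw [mul_neg, KAlg.xi_mul_xi hξ, neg_neg])

theorem neg_isPrimitiveRoot_four (hξ : IsPrimitiveRoot ξ 4) : IsPrimitiveRoot (-ξ) 4 :=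
  inv_eq_neg_of_isPrimitiveRoot_four hξ ▸ hξ.inv

end PrimitiveFourthRoot

namespace KAlg

open Coalgebra

variable {𝕜 : Type*} [Field 𝕜] {ξ : 𝕜} {hξ : IsPrimitiveRoot ξ 4}

theorem adjoin_a_c : Algebra.adjoin 𝕜 {a hξ, c hξ} = ⊤ := by
  have ha : a hξ ∈ Algebra.adjoin 𝕜 {a hξ, c hξ} := Algebra.subset_adjoin (by simp)
  have hc : c hξ ∈ Algebra.adjoin 𝕜 {a hξ, c hξ} := Algebra.subset_adjoin (by simp)
  rw [eq_top_iff, ← adjoin_gens, Algebra.adjoin_le_iff]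
  rintro x (rfl | rfl | rfl | rfl)
  · exact ha
  · rw [← a_sq_mul_c]; exact mul_mem (pow_mem ha 2) hc
  · exact hc
  · rw [← a_sq_mul_a]; exact mul_mem (pow_mem ha 2) ha

theorem isSkewPair_a_c : IsSkewPair ξ 0 (a hξ) (c hξ) where
  pow_four := a_pow_four
  mul_comm := a_mul_c
  mul_self := by rw [c_mul_c, zero_smul]

theorem comul_a : comul (R := 𝕜) (a hξ) = a hξ ⊗ₜ a hξ + b hξ ⊗ₜ c hξ := by simp [comul_eq]
theorem comul_b : comul (R := 𝕜) (b hξ) = a hξ ⊗ₜ b hξ + b hξ ⊗ₜ d hξ := by simp [comul_eq]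
theorem comul_c : comul (R := 𝕜) (c hξ) = c hξ ⊗ₜ a hξ + d hξ ⊗ₜ c hξ := by simp [comul_eq]
theorem comul_d : comul (R := 𝕜) (d hξ) = c hξ ⊗ₜ b hξ + d hξ ⊗ₜ d hξ := by simp [comul_eq]

@[simp] theorem counit_a : counit (R := 𝕜) (a hξ) = 1 := by simp [counit_eq]
@[simp] theorem counit_b : counit (R := 𝕜) (b hξ) = 0 := by simp [counit_eq]
@[simp] theorem counit_c : counit (R := 𝕜) (c hξ) = 0 := by simp [counit_eq]
@[simp] theorem counit_d : counit (R := 𝕜) (d hξ) = 1 := by simp [counit_eq]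

@[simp] theorem alpha_a : alpha hξ (a hξ) = -ξ := by
  simp [alpha, inv_eq_neg_of_isPrimitiveRoot_four hξ]
@[simp] theorem alpha_b : alpha hξ (b hξ) = 0 := by simp [alpha]
@[simp] theorem alpha_c : alpha hξ (c hξ) = 0 := by simp [alpha]
@[simp] theorem alpha_d : alpha hξ (d hξ) = ξ := by simp [alpha]

section skewPrim

variable (s : 𝕜)

@[simp] theorem skewPrim_a : skewPrim hξ s (a hξ) = 0 := (skewPrim_values hξ s).2.1
@[simp] theorem skewPrim_b : skewPrim hξ s (b hξ) = s * ξ := (skewPrim_values hξ s).2.2.1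
@[simp] theorem skewPrim_c : skewPrim hξ s (c hξ) = s * ξ := (skewPrim_values hξ s).2.2.2.1
@[simp] theorem skewPrim_d : skewPrim hξ s (d hξ) = 0 := (skewPrim_values hξ s).2.2.2.2.1

theorem skewRep_eq (t : 𝕜) (u : KAlg hξ) :
    skewRep hξ t u 0 0 = counit (R := 𝕜) u ∧ skewRep hξ t u 1 0 = 0 ∧
      skewRep hξ t u 1 1 = alpha hξ u := by
  refine forall_of_adjoin_eq_top adjoin_a_c
    (p := fun u => skewRep hξ t u 0 0 = counit (R := 𝕜) u ∧ skewRep hξ t u 1 0 = 0 ∧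
      skewRep hξ t u 1 1 = alpha hξ u)
    ?_ (fun r => ?_) (fun u v hu hv => ?_) (fun u v hu hv => ?_) u
  · rintro _ (rfl | rfl) <;> simp [skewRep, alpha]
  · simp [Matrix.algebraMap_matrix_apply]
  · simp [hu, hv]
  · simp [Matrix.mul_apply, hu, hv]

theorem skewPrim_mul (u v : KAlg hξ) : skewPrim hξ s (u * v) =
    counit (R := 𝕜) u * skewPrim hξ s v + skewPrim hξ s u * alpha hξ v := by
  simp [skewPrim, Matrix.mul_apply, skewRep_eq]

theorem skewPrim_a_pow (k : ℕ) : skewPrim hξ s (a hξ ^ k) = 0 := by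
  induction k with
  | zero => exact pow_zero (a hξ) ▸ (skewPrim_values hξ s).1
  | succ k ih => simp [pow_succ, skewPrim_mul, ih]

end skewPrim

/-- The dual algebra of the coalgebra underlying `K^cop`. -/
abbrev Dual (hξ : IsPrimitiveRoot ξ 4) : Type _ := DualAlg 𝕜 (Cop 𝕜 (KAlg hξ))

variable (hξ) in
/-- The character `α₁` of `K` as an element of the dual algebra. -/
def gDual : Dual hξ := ev.symm (alpha hξ).toLinearMap

variable (hξ) in
/-- The functional `θ` as an element of the dual algebra. -/
def xDual (s : 𝕜) : Dual hξ := ev.symm (skewPrim hξ s)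

variable (hξ) in
/-- The automorphism of `K` by which `gDual` acts on `K`. -/
abbrev gTwist : KAlg hξ →ₐ[𝕜] KAlg hξ := contractAlgHom (alpha hξ)

@[simp] theorem gTwist_a : gTwist hξ (a hξ) = -ξ • a hξ := by
  simp [← contract_toLinearMap, contract_apply, comul_a]

@[simp] theorem gTwist_c : gTwist hξ (c hξ) = ξ • c hξ := by
  simp [← contract_toLinearMap, contract_apply, comul_c]

variable (hξ) in
/-- The skew derivation of `K` by which `xDual` acts on `K`. -/
abbrev skewDer (s : 𝕜) : KAlg hξ →ₗ[𝕜] KAlg hξ := contract (skewPrim hξ s)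

theorem coregular_gDual : coregular 𝕜 _ (gDual hξ) = (gTwist hξ).toLinearMap := by
  rw [coregular_apply, gDual, LinearEquiv.apply_symm_apply]
  rfl

theorem coregular_xDual (s : 𝕜) : coregular 𝕜 _ (xDual hξ s) = skewDer hξ s := by
  rw [coregular_apply, xDual, LinearEquiv.apply_symm_apply]

theorem skewDer_a (s : 𝕜) : skewDer hξ s (a hξ) = (s * ξ) • c hξ := by
  simp [skewDer, contract_apply, comul_a]

theorem skewDer_c (s : 𝕜) : skewDer hξ s (c hξ) = (s * ξ) • a hξ := by
  simp [skewDer, contract_apply, comul_c]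

theorem skewDer_mul (s : 𝕜) (u v : KAlg hξ) : skewDer hξ s (u * v) =
    u * skewDer hξ s v + skewDer hξ s u * gTwist hξ v := by
  simpa only [contract_counit, contract_toLinearMap, LinearMap.id_apply] using
    contract_mul_of_leibniz (τ := (alpha hξ).toLinearMap) (skewPrim_mul s) u v

theorem gTwist_gTwist_a : gTwist hξ (gTwist hξ (a hξ)) = -a hξ := by
  simp [smul_smul, xi_mul_xi hξ]

theorem gTwist_gTwist_c : gTwist hξ (gTwist hξ (c hξ)) = -c hξ := by
  simp [smul_smul, xi_mul_xi hξ]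

theorem gDual_pow_four : gDual hξ ^ 4 = 1 := by
  refine coregular_injective ?_
  have h : (gTwist hξ).comp ((gTwist hξ).comp ((gTwist hξ).comp (gTwist hξ))) = .id 𝕜 _ := by
    refine AlgHom.ext_of_adjoin_eq_top adjoin_a_c ?_
    rintro _ (rfl | rfl)
    · simp only [AlgHom.comp_apply, gTwist_gTwist_a, map_neg, neg_neg, AlgHom.id_apply]
    · simp only [AlgHom.comp_apply, gTwist_gTwist_c, map_neg, neg_neg, AlgHom.id_apply]
  rw [map_pow, map_one, coregular_gDual]
  exact LinearMap.ext fun u => AlgHom.congr_fun h u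

theorem skewDer_gTwist (s : 𝕜) (u : KAlg hξ) :
    gTwist hξ (skewDer hξ s u) + skewDer hξ s (gTwist hξ u) = 0 := by
  refine LinearMap.congr_fun (eq_zero_of_twisted_leibniz adjoin_a_c (gTwist hξ)
    ((gTwist hξ).comp (gTwist hξ)) (L := (gTwist hξ).toLinearMap ∘ₗ skewDer hξ s +
      skewDer hξ s ∘ₗ (gTwist hξ).toLinearMap) (fun u v => ?_) ?_) u
  · simp only [LinearMap.add_apply, LinearMap.comp_apply, AlgHom.toLinearMap_apply,
      AlgHom.comp_apply, skewDer_mul, map_add, map_mul]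
    noncomm_ring
  · rintro _ (rfl | rfl) <;>
      simp [skewDer_a, skewDer_c, smul_smul, mul_comm]

theorem skewDer_skewDer {s : 𝕜} (hs : s ^ 2 = 2) (u : KAlg hξ) :
    skewDer hξ s (skewDer hξ s u) = gTwist hξ (gTwist hξ u) - u := by
  have hsξ : s * ξ * (s * ξ) = -2 := by
    linear_combination ξ * ξ * hs + 2 * xi_mul_xi hξ
  rw [← sub_eq_zero]
  refine LinearMap.congr_fun (eq_zero_of_twisted_leibniz adjoin_a_c (.id 𝕜 _)
    ((gTwist hξ).comp (gTwist hξ)) (L := skewDer hξ s ∘ₗ skewDer hξ s -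
      ((gTwist hξ).toLinearMap ∘ₗ (gTwist hξ).toLinearMap - LinearMap.id)) (fun u v => ?_) ?_) u
  · have anticomm : skewDer hξ s (gTwist hξ v) = -gTwist hξ (skewDer hξ s v) :=
      eq_neg_of_add_eq_zero_right (skewDer_gTwist s v)
    simp only [LinearMap.sub_apply, LinearMap.comp_apply, AlgHom.toLinearMap_apply,
      AlgHom.comp_apply, AlgHom.id_apply, LinearMap.id_apply, skewDer_mul, map_add, map_mul,
      anticomm]
    noncomm_ring
  · rintro _ (rfl | rfl)
    · simp only [LinearMap.sub_apply, LinearMap.comp_apply, AlgHom.toLinearMap_apply,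
        LinearMap.id_apply, gTwist_gTwist_a, skewDer_a, skewDer_c, map_smul, smul_smul, hsξ]
      module
    · simp only [LinearMap.sub_apply, LinearMap.comp_apply, AlgHom.toLinearMap_apply,
        LinearMap.id_apply, gTwist_gTwist_c, skewDer_a, skewDer_c, map_smul, smul_smul, hsξ]
      module

theorem isSkewPair_gDual_xDual {s : 𝕜} (hs : s ^ 2 = 2) :
    IsSkewPair (-1 : 𝕜) 1 (gDual hξ) (xDual hξ s) where
  pow_four := gDual_pow_four
  mul_comm := coregular_injective <| LinearMap.ext fun u => by
    simpa [coregular_gDual, coregular_xDual] using eq_neg_of_add_eq_zero_left (skewDer_gTwist s u)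
  mul_self := coregular_injective <| LinearMap.ext fun u => by
    simpa [coregular_gDual, coregular_xDual] using skewDer_skewDer hs u

open IsSkewPair

theorem ev_mul_gDual_pow (f : Dual hξ) (n : ℕ) {u : KAlg hξ} {r : 𝕜} (hu : gTwist hξ u = r • u) :
    ev (f * gDual hξ ^ n) u = r ^ n * ev f u := by
  have h : (coregular 𝕜 _ (gDual hξ)).HasEigenvector r u ∨ u = 0 := by
    rw [coregular_gDual]
    exact or_iff_not_imp_right.2 fun hu0 => ⟨Module.End.mem_eigenspace_iff.2 hu, hu0⟩
  rw [ev_mul, ← coregular_apply, map_pow]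
  obtain h | rfl := h
  · rw [h.pow_apply, map_smul, smul_eq_mul]
  · simp

theorem ev_gDual_pow (n : ℕ) {u : KAlg hξ} {r : 𝕜} (hu : gTwist hξ u = r • u) :
    ev (gDual hξ ^ n) u = r ^ n * counit (R := 𝕜) u := by
  rw [← one_mul (gDual hξ ^ n), ev_mul_gDual_pow 1 n hu, ev_one]

theorem gTwist_a_pow (k : ℕ) : gTwist hξ (a hξ ^ k) = (-ξ) ^ k • a hξ ^ k := by
  rw [map_pow, gTwist_a, smul_pow]

theorem gTwist_c_mul_a_pow (k : ℕ) :
    gTwist hξ (c hξ * a hξ ^ k) = (ξ * (-ξ) ^ k) • (c hξ * a hξ ^ k) := by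
  rw [map_mul, gTwist_c, gTwist_a_pow, smul_mul_smul_comm]

variable (hξ) in
/-- The pairing of the monomials in `gDual`, `xDual` with the monomials in `a`, `c`. -/
def pairing (s : 𝕜) : Matrix (Fin 4 ⊕ Fin 4) (Fin 4 ⊕ Fin 4) 𝕜 :=
  .of fun i j => ev (monomials (gDual hξ) (xDual hξ s) i) (monomials (a hξ) (c hξ) j)

theorem pairing_eq_fromBlocks (s : 𝕜) : pairing hξ s =
    .fromBlocks (Matrix.vandermonde fun k : Fin 4 => (-ξ) ^ k.val).transpose 0 0
      ((Matrix.vandermonde fun k : Fin 4 => ξ * (-ξ) ^ k.val).transpose *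
        .diagonal fun k : Fin 4 => s * ξ * (-ξ) ^ k.val) := by
  have hx (u) : ev (xDual hξ s) u = skewPrim hξ s u := by rw [xDual, LinearEquiv.apply_symm_apply]
  ext (n | n) (k | k)
  · simp [pairing, monomials, ev_gDual_pow _ (gTwist_a_pow _)]
  · simp [pairing, monomials, ev_gDual_pow _ (gTwist_c_mul_a_pow _)]
  · simp [pairing, monomials, ev_mul_gDual_pow _ _ (gTwist_a_pow _), hx, skewPrim_a_pow]
  · simp [pairing, monomials, ev_mul_gDual_pow _ _ (gTwist_c_mul_a_pow _), hx, skewPrim_mul,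
      Matrix.vandermonde]

theorem isUnit_pairing (hξ : IsPrimitiveRoot ξ 4) {s : 𝕜} (hs : s ≠ 0) :
    IsUnit (pairing hξ s) := by
  have hξ0 : ξ ≠ 0 := hξ.ne_zero four_ne_zero
  have inj : Function.Injective fun k : Fin 4 => (-ξ) ^ k.val := fun k l h =>
    Fin.ext ((neg_isPrimitiveRoot_four hξ).pow_inj k.isLt l.isLt h)
  rw [Matrix.isUnit_iff_isUnit_det, isUnit_iff_ne_zero, pairing_eq_fromBlocks,
    Matrix.det_fromBlocks_zero₁₂, Matrix.det_mul, Matrix.det_transpose, Matrix.det_transpose,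
    Matrix.det_diagonal]
  refine mul_ne_zero (Matrix.det_vandermonde_ne_zero_iff.2 inj) (mul_ne_zero
    (Matrix.det_vandermonde_ne_zero_iff.2 ((mul_right_injective₀ hξ0).comp inj)) ?_)
  exact Finset.prod_ne_zero_iff.2 fun k _ =>
    mul_ne_zero (mul_ne_zero hs hξ0) (pow_ne_zero _ (neg_ne_zero.2 hξ0))

theorem linearIndependent_monomials_gDual_xDual {s : 𝕜} (hs : s ≠ 0) :
    LinearIndependent 𝕜 (monomials (gDual hξ) (xDual hξ s)) :=
  linearIndependent_of_isUnit_pairing (ev (𝕜 := 𝕜) (H := KAlg hξ)).toLinearMap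
    (isUnit_pairing hξ hs)

theorem linearIndependent_monomials_a_c : LinearIndependent 𝕜 (monomials (a hξ) (c hξ)) :=
  linearIndependent_of_isUnit_pairing (ev (𝕜 := 𝕜) (H := KAlg hξ)).toLinearMap.flip
    ((Matrix.isUnit_transpose _).2 (isUnit_pairing hξ one_ne_zero))

theorem finrank_eq : Module.finrank 𝕜 (KAlg hξ) = 8 := by
  simpa using Module.finrank_eq_card_basis
    (.mk linearIndependent_monomials_a_c (isSkewPair_a_c.span_monomials (adjoin_a_c (hξ := hξ))).ge)

theorem finrank_dual_eq : Module.finrank 𝕜 (Dual hξ) = 8 :=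
  (ev (𝕜 := 𝕜) (H := KAlg hξ)).finrank_eq.trans (Subspace.dual_finrank_eq.trans finrank_eq)

variable (hξ) in
/-- The basis of the dual algebra formed by the monomials in `gDual` and `xDual`. -/
def dualBasis {s : 𝕜} (hs : s ≠ 0) : Module.Basis (Fin 4 ⊕ Fin 4) 𝕜 (Dual hξ) :=
  basisOfLinearIndependentOfCardEqFinrank (linearIndependent_monomials_gDual_xDual hs)
    (by simp [finrank_dual_eq])

theorem coe_dualBasis {s : 𝕜} (hs : s ≠ 0) :
    ⇑(dualBasis hξ hs) = monomials (gDual hξ) (xDual hξ s) :=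
  coe_basisOfLinearIndependentOfCardEqFinrank _ _

theorem adjoin_gDual_xDual {s : 𝕜} (hs : s ≠ 0) :
    Algebra.adjoin 𝕜 {gDual hξ, xDual hξ s} = ⊤ :=
  adjoin_eq_top_of_span_monomials (coe_dualBasis (hξ := hξ) hs ▸ (dualBasis hξ hs).span_eq)

end KAlg

namespace DrinfeldDouble

variable (𝕜 : Type*) (H : Type*) [Field 𝕜] [Ring H] [HopfAlgebra 𝕜 H] [HasBijectiveAntipode 𝕜 H]

theorem bowtie_one_mul (f g : DualAlg 𝕜 H) (k : H) :
    bowtie 𝕜 H f 1 * bowtie 𝕜 H g k = bowtie 𝕜 H (f * g) k := by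
  rw [bowtie_mul_bowtie, comul3_one, straighten_one]
  rfl

theorem one_bowtie_mul (h : H) (g : DualAlg 𝕜 H) (k : H) :
    bowtie 𝕜 H 1 h * bowtie 𝕜 H g k = straighten 𝕜 H (comul3 𝕜 H h) (g ⊗ₜ k) := by
  have leftDual_one : leftDual 𝕜 H 1 = LinearMap.id := by ext; simp
  rw [bowtie_mul_bowtie, leftDual_one, LinearMap.id_apply]

theorem one_bowtie_mul_one_bowtie (h k : H) :
    bowtie 𝕜 H 1 h * bowtie 𝕜 H 1 k = bowtie 𝕜 H 1 (h * k) := by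
  rw [one_bowtie_mul, straighten_mulRight]
  exact congr_arg ((LinearMap.mulRight 𝕜 k).lTensor _) (leftH_apply_one 𝕜 H h)

/-- The inclusion `h ↦ ε ⋈ h` of `H` into its double. -/
def inclH : H →ₐ[𝕜] DrinfeldDouble 𝕜 H :=
  AlgHom.ofLinearMap (TensorProduct.mk 𝕜 (DualAlg 𝕜 H) H 1 : H →ₗ[𝕜] DrinfeldDouble 𝕜 H) rfl
    fun h k => (one_bowtie_mul_one_bowtie 𝕜 H h k).symm

/-- The inclusion `f ↦ f ⋈ 1` of the dual algebra of `H` into the double of `H`. -/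
def inclDual : DualAlg 𝕜 H →ₐ[𝕜] DrinfeldDouble 𝕜 H :=
  AlgHom.ofLinearMap
    ((TensorProduct.mk 𝕜 (DualAlg 𝕜 H) H).flip 1 : DualAlg 𝕜 H →ₗ[𝕜] DrinfeldDouble 𝕜 H) rfl
    fun f g => (bowtie_one_mul 𝕜 H f g 1).symm

variable {𝕜 H}

theorem inclDual_mul_inclH (f : DualAlg 𝕜 H) (h : H) :
    inclDual 𝕜 H f * inclH 𝕜 H h = bowtie 𝕜 H f h :=
  (bowtie_one_mul 𝕜 H f 1 h).trans (by rw [mul_one])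

theorem inclH_mul_inclDual (h : H) (f : DualAlg 𝕜 H) :
    inclH 𝕜 H h * inclDual 𝕜 H f = straighten 𝕜 H (comul3 𝕜 H h) (f ⊗ₜ 1) :=
  one_bowtie_mul 𝕜 H h f 1

theorem induction {P : DrinfeldDouble 𝕜 H → Prop} (zero : P 0)
    (add : ∀ x y, P x → P y → P (x + y))
    (mul : ∀ f h, P (inclDual 𝕜 H f * inclH 𝕜 H h)) (z : DrinfeldDouble 𝕜 H) : P z :=
  TensorProduct.induction_on (motive := P) z zero
    (fun f h => (congr_arg P (inclDual_mul_inclH f h)).mp (mul f h)) add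

theorem adjoin_union_eq_top {F : Set (DualAlg 𝕜 H)} (hF : Algebra.adjoin 𝕜 F = ⊤) {T : Set H}
    (hT : Algebra.adjoin 𝕜 T = ⊤) :
    Algebra.adjoin 𝕜 (inclDual 𝕜 H '' F ∪ inclH 𝕜 H '' T) = ⊤ := by
  rw [Algebra.adjoin_union, ← AlgHom.map_adjoin, ← AlgHom.map_adjoin, hF, hT]
  refine Algebra.eq_top_iff.2 fun z => ?_
  induction z using induction with
  | zero => exact zero_mem _
  | add x y hx hy => exact add_mem hx hy
  | mul f h =>
    exact mul_mem (le_sup_left (α := Subalgebra 𝕜 _) ⟨f, Algebra.mem_top, rfl⟩)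
      (le_sup_right (α := Subalgebra 𝕜 _) ⟨h, Algebra.mem_top, rfl⟩)

section lift

variable {A : Type*} [Ring A] [Algebra 𝕜 A] (ψ : DualAlg 𝕜 H →ₐ[𝕜] A) (φ : H →ₐ[𝕜] A)

/-- The linear map `f ⋈ h ↦ ψ f * φ h`. -/
def liftLinear : DrinfeldDouble 𝕜 H →ₗ[𝕜] A :=
  (LinearMap.mul' 𝕜 A ∘ₗ TensorProduct.map ψ.toLinearMap φ.toLinearMap :
    DualAlg 𝕜 H ⊗[𝕜] H →ₗ[𝕜] A)

@[simp] theorem liftLinear_inclDual_mul_inclH (f : DualAlg 𝕜 H) (h : H) :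
    liftLinear ψ φ (inclDual 𝕜 H f * inclH 𝕜 H h) = ψ f * φ h := by
  rw [inclDual_mul_inclH]
  rfl

@[simp] theorem liftLinear_inclDual (f : DualAlg 𝕜 H) :
    liftLinear ψ φ (inclDual 𝕜 H f) = ψ f := by
  simpa using liftLinear_inclDual_mul_inclH ψ φ f 1

@[simp] theorem liftLinear_inclH (h : H) : liftLinear ψ φ (inclH 𝕜 H h) = φ h := by
  simpa using liftLinear_inclDual_mul_inclH ψ φ 1 h

theorem liftLinear_inclDual_mul (f : DualAlg 𝕜 H) (z : DrinfeldDouble 𝕜 H) :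
    liftLinear ψ φ (inclDual 𝕜 H f * z) = ψ f * liftLinear ψ φ z := by
  induction z using induction with
  | zero => simp
  | add x y hx hy => simp only [mul_add, map_add, hx, hy]
  | mul g h =>
    rw [← mul_assoc, ← map_mul, liftLinear_inclDual_mul_inclH, liftLinear_inclDual_mul_inclH,
      map_mul, mul_assoc]

theorem liftLinear_mul_inclH (z : DrinfeldDouble 𝕜 H) (h : H) :
    liftLinear ψ φ (z * inclH 𝕜 H h) = liftLinear ψ φ z * φ h := by
  induction z using induction with
  | zero => simp
  | add x y hx hy => simp only [add_mul, map_add, hx, hy]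
  | mul g k =>
    rw [mul_assoc, ← map_mul, liftLinear_inclDual_mul_inclH, liftLinear_inclDual_mul_inclH,
      map_mul, mul_assoc]

variable (H) in
/-- The subspace of the double spanned by the products `f ⋈ h` with `f ∈ F`. -/
def mulSpan (F : Set (DualAlg 𝕜 H)) : Submodule 𝕜 (DrinfeldDouble 𝕜 H) :=
  .span 𝕜 (Set.image2 (fun f h => inclDual 𝕜 H f * inclH 𝕜 H h) F Set.univ)

variable {F : Set (DualAlg 𝕜 H)} {T : Set H}

theorem inclDual_mul_inclH_mem_mulSpan {f : DualAlg 𝕜 H} (hf : f ∈ F) (h : H) :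
    inclDual 𝕜 H f * inclH 𝕜 H h ∈ mulSpan H F :=
  Submodule.subset_span ⟨f, hf, h, Set.mem_univ h, rfl⟩

theorem mul_inclH_mem_mulSpan {z : DrinfeldDouble 𝕜 H} (hz : z ∈ mulSpan H F) (h : H) :
    z * inclH 𝕜 H h ∈ mulSpan H F := by
  induction hz using Submodule.span_induction with
  | mem z hz =>
    obtain ⟨f, hf, k, -, rfl⟩ := hz
    rw [mul_assoc, ← map_mul]
    exact inclDual_mul_inclH_mem_mulSpan hf _
  | zero => rw [zero_mul]; exact zero_mem _
  | add x y _ _ hx hy => rw [add_mul]; exact add_mem hx hy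
  | smul r x _ hx => rw [smul_mul_assoc]; exact (mulSpan H F).smul_mem r hx

theorem liftLinear_inclH_mul_of_mem (hT : Algebra.adjoin 𝕜 T = ⊤)
    (mem : ∀ t ∈ T, ∀ f ∈ F, inclH 𝕜 H t * inclDual 𝕜 H f ∈ mulSpan H F)
    (compat : ∀ t ∈ T, ∀ f ∈ F, liftLinear ψ φ (inclH 𝕜 H t * inclDual 𝕜 H f) = φ t * ψ f)
    (h : H) {z : DrinfeldDouble 𝕜 H} (hz : z ∈ mulSpan H F) :
    liftLinear ψ φ (inclH 𝕜 H h * z) = φ h * liftLinear ψ φ z := by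
  suffices ∀ z ∈ mulSpan H F, inclH 𝕜 H h * z ∈ mulSpan H F ∧
    liftLinear ψ φ (inclH 𝕜 H h * z) = φ h * liftLinear ψ φ z from (this z hz).2
  clear! z
  refine forall_of_adjoin_eq_top hT (p := fun h => ∀ z ∈ mulSpan H F,
    inclH 𝕜 H h * z ∈ mulSpan H F ∧ liftLinear ψ φ (inclH 𝕜 H h * z) = φ h * liftLinear ψ φ z)
    (fun t ht z hz => ?_) (fun r z hz => ?_) (fun h k hh hk z hz => ?_)
    (fun h k hh hk z hz => ?_) h
  · induction hz using Submodule.span_induction with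
    | mem z hz =>
      obtain ⟨f, hf, k, -, rfl⟩ := hz
      rw [← mul_assoc]
      refine ⟨mul_inclH_mem_mulSpan (mem t ht f hf) k, ?_⟩
      rw [liftLinear_mul_inclH, compat t ht f hf, liftLinear_inclDual_mul_inclH, mul_assoc]
    | zero => simp
    | add x y _ _ hx hy =>
      simp only [mul_add, map_add, hx, hy, and_true]
      exact add_mem hx.1 hy.1
    | smul r x _ hx =>
      simp only [mul_smul_comm, map_smul, hx, and_true]
      exact (mulSpan H F).smul_mem r hx.1
  · simp only [AlgHom.commutes, ← Algebra.smul_def, map_smul, and_true]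
    exact (mulSpan H F).smul_mem r hz
  · simp only [map_add, add_mul, (hh z hz).2, (hk z hz).2, and_true]
    exact add_mem (hh z hz).1 (hk z hz).1
  · simp only [map_mul, mul_assoc, (hh _ (hk z hz).1).2, (hk z hz).2, and_true]
    exact (hh _ (hk z hz).1).1

theorem liftLinear_mul_inclDual {f : DualAlg 𝕜 H}
    (hf : ∀ h, liftLinear ψ φ (inclH 𝕜 H h * inclDual 𝕜 H f) = φ h * ψ f)
    (z : DrinfeldDouble 𝕜 H) :
    liftLinear ψ φ (z * inclDual 𝕜 H f) = liftLinear ψ φ z * ψ f := by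
  induction z using induction with
  | zero => simp
  | add x y hx hy => simp only [add_mul, map_add, hx, hy]
  | mul g k => rw [mul_assoc, liftLinear_inclDual_mul, hf, liftLinear_inclDual_mul_inclH, mul_assoc]

theorem liftLinear_mul (hT : Algebra.adjoin 𝕜 T = ⊤) (hF : Algebra.adjoin 𝕜 F = ⊤)
    (mem : ∀ t ∈ T, ∀ f ∈ F, inclH 𝕜 H t * inclDual 𝕜 H f ∈ mulSpan H F)
    (compat : ∀ t ∈ T, ∀ f ∈ F, liftLinear ψ φ (inclH 𝕜 H t * inclDual 𝕜 H f) = φ t * ψ f)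
    (z w : DrinfeldDouble 𝕜 H) :
    liftLinear ψ φ (z * w) = liftLinear ψ φ z * liftLinear ψ φ w := by
  have cross : ∀ f h, liftLinear ψ φ (inclH 𝕜 H h * inclDual 𝕜 H f) = φ h * ψ f := by
    refine forall_of_adjoin_eq_top hF (fun f hf h => ?_) (fun r h => ?_) (fun f g hf hg h => ?_)
      (fun f g hf hg h => ?_)
    · have hf' : inclDual 𝕜 H f ∈ mulSpan H F := by
        simpa using inclDual_mul_inclH_mem_mulSpan hf 1
      rw [liftLinear_inclH_mul_of_mem ψ φ hT mem compat h hf', liftLinear_inclDual]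
    · simp only [AlgHom.commutes, ← Algebra.commutes r, ← Algebra.smul_def, map_smul,
        liftLinear_inclH]
    · simp only [map_add, mul_add, hf, hg]
    · rw [map_mul (inclDual 𝕜 H), ← mul_assoc, liftLinear_mul_inclDual ψ φ hg, hf, map_mul,
        mul_assoc]
  induction w using induction with
  | zero => simp
  | add x y hx hy => simp only [mul_add, map_add, hx, hy]
  | mul f h =>
    rw [← mul_assoc, liftLinear_mul_inclH, liftLinear_mul_inclDual ψ φ (cross f),
      liftLinear_inclDual_mul_inclH, mul_assoc]

variable (hT : Algebra.adjoin 𝕜 T = ⊤) (hF : Algebra.adjoin 𝕜 F = ⊤)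
  (mem : ∀ t ∈ T, ∀ f ∈ F, inclH 𝕜 H t * inclDual 𝕜 H f ∈ mulSpan H F)
  (compat : ∀ t ∈ T, ∀ f ∈ F, liftLinear ψ φ (inclH 𝕜 H t * inclDual 𝕜 H f) = φ t * ψ f)

/-- The algebra map `f ⋈ h ↦ ψ f * φ h`. It suffices that `ψ` and `φ` are compatible with the
commutation relations between generators `T` of `H` and `F` of the dual, provided that these
relations are closed in `F`. -/
def lift : DrinfeldDouble 𝕜 H →ₐ[𝕜] A :=
  AlgHom.ofLinearMap (liftLinear ψ φ) ((liftLinear_inclDual ψ φ 1).trans (map_one ψ))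
    (liftLinear_mul ψ φ hT hF mem compat)

theorem lift_inclH (h : H) : lift ψ φ hT hF mem compat (inclH 𝕜 H h) = φ h :=
  liftLinear_inclH ψ φ h

theorem lift_inclDual (f : DualAlg 𝕜 H) :
    lift ψ φ hT hF mem compat (inclDual 𝕜 H f) = ψ f := liftLinear_inclDual ψ φ f

end lift

end DrinfeldDouble

namespace KAlg

variable {𝕜 : Type*} [Field 𝕜] {ξ : 𝕜} {hξ : IsPrimitiveRoot ξ 4}

theorem antipode_a : HopfAlgebra.antipode 𝕜 (a hξ) = d hξ := by
  simp [antipode_eq, antipodeOp]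
theorem antipode_b : HopfAlgebra.antipode 𝕜 (b hξ) = ξ • b hξ := by
  simp [antipode_eq, antipodeOp]
theorem antipode_c : HopfAlgebra.antipode 𝕜 (c hξ) = -ξ • c hξ := by
  simp [antipode_eq, antipodeOp]
theorem antipode_d : HopfAlgebra.antipode 𝕜 (d hξ) = a hξ := by
  simp [antipode_eq, antipodeOp]

end KAlg

/-- The relations between the generators `a, c` of `K` and `g, x` of its dual inside `D`, together
with the relations within each pair. -/
structure IsDTuple {𝕜 A : Type*} [Field 𝕜] [Ring A] [Algebra 𝕜 A] (ξ s : 𝕜) (a c g x : A) :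
    Prop where
  isSkewPair_a_c : IsSkewPair ξ 0 a c
  isSkewPair_g_x : IsSkewPair (-1 : 𝕜) 1 g x
  a_mul_g : a * g = g * a
  c_mul_g : c * g = -(g * c)
  a_mul_x : a * x = -ξ • (x * a) + (s * ξ) • (a ^ 2 * c + g * c)
  c_mul_x : c * x = -ξ • (x * c) + (s * ξ) • (a ^ 3 - g * a)

namespace DK

open KAlg (Dual gDual xDual antipode_a antipode_b antipode_c antipode_d)

variable {𝕜 : Type*} [Field 𝕜] {ξ : 𝕜} {hξ : IsPrimitiveRoot ξ 4}

theorem finrank_eq : Module.finrank 𝕜 (DK hξ) = 64 := by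
  have hK : Module.finrank 𝕜 (Cop 𝕜 (KAlg hξ)) = 8 := KAlg.finrank_eq
  change Module.finrank 𝕜 (Dual hξ ⊗[𝕜] Cop 𝕜 (KAlg hξ)) = 64
  rw [Module.finrank_tensorProduct, KAlg.finrank_dual_eq, hK]

variable (hξ) in
/-- The inclusion of `K` into `D`. -/
def inclK : KAlg hξ →ₐ[𝕜] DK hξ :=
  (DrinfeldDouble.inclH 𝕜 (Cop 𝕜 (KAlg hξ))).comp (toCop 𝕜 (KAlg hξ)).toAlgHom

variable (hξ) in
/-- The inclusion of the dual algebra into `D`. -/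
abbrev inclDual : Dual hξ →ₐ[𝕜] DK hξ := DrinfeldDouble.inclDual 𝕜 (Cop 𝕜 (KAlg hξ))

theorem inclK_a : inclK hξ (KAlg.a hξ) = a hξ := rfl
theorem inclK_b : inclK hξ (KAlg.b hξ) = b hξ := rfl
theorem inclK_c : inclK hξ (KAlg.c hξ) = c hξ := rfl
theorem inclK_d : inclK hξ (KAlg.d hξ) = d hξ := rfl
theorem inclDual_gDual : inclDual hξ (gDual hξ) = g hξ := rfl
theorem inclDual_xDual (s : 𝕜) : inclDual hξ (xDual hξ s) = x hξ s := rfl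

theorem b_eq : b hξ = a hξ ^ 2 * c hξ := by
  rw [← inclK_a, ← inclK_b, ← inclK_c, ← map_pow, ← map_mul, KAlg.a_sq_mul_c]

theorem d_eq : d hξ = a hξ ^ 3 := by
  rw [← inclK_a, ← inclK_d, ← map_pow, pow_succ, KAlg.a_sq_mul_a]

/-- The functional `u ↦ f (S(q) u p)`. -/
def coact (p q : KAlg hξ) (f : Dual hξ) : Dual hξ :=
  coadjFun 𝕜 (Cop 𝕜 (KAlg hξ)) (toCop 𝕜 _ p) (toCop 𝕜 _ q) f

theorem ev_coact (p q : KAlg hξ) (f : Dual hξ) (u : KAlg hξ) :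
    ev (coact p q f) u = ev f (HopfAlgebra.antipode 𝕜 q * u * p) := by
  have h : ev (coact p q f) u =
    ev f ((toCop 𝕜 _).symm (invAntipode 𝕜 _ (toCop 𝕜 _ q)) * u * p) := rfl
  rw [h, invAntipode_toCop, AlgEquiv.symm_apply_apply]

open KAlg in
theorem coact_gDual (p q : KAlg hξ) :
    coact p q (gDual hξ) = (alpha hξ (HopfAlgebra.antipode 𝕜 q) * alpha hξ p) • gDual hξ := by
  refine ev.injective (LinearMap.ext fun u => ?_)
  simp only [ev_coact, gDual, map_smul, LinearEquiv.apply_symm_apply, LinearMap.smul_apply,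
    AlgHom.toLinearMap_apply, map_mul, smul_eq_mul]
  ring

open KAlg in
theorem coact_xDual (s : 𝕜) (p q : KAlg hξ) :
    coact p q (xDual hξ s) =
      (Coalgebra.counit (R := 𝕜) q * skewPrim hξ s p) • 1 +
      (Coalgebra.counit (R := 𝕜) q * alpha hξ p) • xDual hξ s +
      (skewPrim hξ s (HopfAlgebra.antipode 𝕜 q) * alpha hξ p) • gDual hξ := by
  refine ev.injective (LinearMap.ext fun u => ?_)
  simp only [ev_coact, gDual, xDual, ev_one, map_add, map_smul, LinearEquiv.apply_symm_apply,
    LinearMap.add_apply, LinearMap.smul_apply, AlgHom.toLinearMap_apply, skewPrim_mul,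
    Bialgebra.counit_mul, HopfAlgebra.counit_antipode, smul_eq_mul]
  ring

open Coalgebra in
theorem comul_toCop (u : KAlg hξ) : comul (R := 𝕜) (toCop 𝕜 _ u) =
    TensorProduct.map (toCop 𝕜 (KAlg hξ)).toLinearMap (toCop 𝕜 (KAlg hξ)).toLinearMap
      (TensorProduct.comm 𝕜 _ _ (comul (R := 𝕜) u)) :=
  (LinearMap.congr_fun TensorProduct.map_id (TensorProduct.comm 𝕜 _ _ (comul (R := 𝕜) u))).symm

theorem straighten_toCop (p m q : KAlg hξ) (f : Dual hξ) :
    straighten 𝕜 (Cop 𝕜 (KAlg hξ)) (toCop 𝕜 _ p ⊗ₜ (toCop 𝕜 _ m ⊗ₜ toCop 𝕜 _ q)) (f ⊗ₜ 1) =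
      inclDual hξ (coact p q f) * inclK hξ m := by
  rw [straighten_tmul, mul_one]
  exact (DrinfeldDouble.inclDual_mul_inclH _ _).symm

theorem a_mul_inclDual (f : Dual hξ) : a hξ * inclDual hξ f =
    inclDual hξ (coact (KAlg.a hξ) (KAlg.a hξ) f) * a hξ +
    inclDual hξ (coact (KAlg.a hξ) (KAlg.b hξ) f) * c hξ +
    inclDual hξ (coact (KAlg.c hξ) (KAlg.a hξ) f) * b hξ +
    inclDual hξ (coact (KAlg.c hξ) (KAlg.b hξ) f) * d hξ := by
  refine (DrinfeldDouble.inclH_mul_inclDual (toCop 𝕜 _ (KAlg.a hξ)) f).trans ?_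
  simp only [← inclK_a, ← inclK_b, ← inclK_c, ← inclK_d, ← straighten_toCop]
  simp [comul3, comul_toCop, KAlg.comul_a, KAlg.comul_b, TensorProduct.tmul_add, -straighten_tmul]
  abel

theorem c_mul_inclDual (f : Dual hξ) : c hξ * inclDual hξ f =
    inclDual hξ (coact (KAlg.a hξ) (KAlg.c hξ) f) * a hξ +
    inclDual hξ (coact (KAlg.a hξ) (KAlg.d hξ) f) * c hξ +
    inclDual hξ (coact (KAlg.c hξ) (KAlg.c hξ) f) * b hξ +
    inclDual hξ (coact (KAlg.c hξ) (KAlg.d hξ) f) * d hξ := by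
  refine (DrinfeldDouble.inclH_mul_inclDual (toCop 𝕜 _ (KAlg.c hξ)) f).trans ?_
  simp only [← inclK_a, ← inclK_b, ← inclK_c, ← inclK_d, ← straighten_toCop]
  simp [comul3, comul_toCop, KAlg.comul_c, KAlg.comul_d, TensorProduct.tmul_add, -straighten_tmul]
  abel

theorem a_mul_g : a hξ * g hξ = g hξ * a hξ := by
  rw [← inclDual_gDual, a_mul_inclDual]
  simp [coact_gDual, antipode_a, antipode_b, KAlg.xi_mul_xi hξ]

theorem c_mul_g : c hξ * g hξ = -(g hξ * c hξ) := by
  rw [← inclDual_gDual, c_mul_inclDual]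
  simp [coact_gDual, antipode_c, antipode_d, KAlg.xi_mul_xi hξ]

theorem a_mul_x (s : 𝕜) : a hξ * x hξ s =
    -ξ • (x hξ s * a hξ) + (s * ξ) • (a hξ ^ 2 * c hξ + g hξ * c hξ) := by
  have hx : ξ * (s * ξ) = -s := by linear_combination s * KAlg.xi_mul_xi hξ
  rw [← inclDual_xDual, a_mul_inclDual, ← b_eq]
  simp [coact_xDual, antipode_a, antipode_b, inclDual_gDual, inclDual_xDual, hx]
  abel

theorem c_mul_x (s : 𝕜) : c hξ * x hξ s =
    -ξ • (x hξ s * c hξ) + (s * ξ) • (a hξ ^ 3 - g hξ * a hξ) := by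
  have hx : ξ * (s * ξ) = -s := by linear_combination s * KAlg.xi_mul_xi hξ
  rw [← inclDual_xDual, c_mul_inclDual, ← d_eq]
  simp [coact_xDual, antipode_c, antipode_d, inclDual_gDual, inclDual_xDual, hx]
  module

end DK

theorem IsSkewPair.map {𝕜 A B : Type*} [CommRing 𝕜] [Ring A] [Algebra 𝕜 A] [Ring B] [Algebra 𝕜 B]
    {r p : 𝕜} {z y : A} (h : IsSkewPair r p z y) (f : A →ₐ[𝕜] B) :
    IsSkewPair r p (f z) (f y) where
  pow_four := by rw [← map_pow, h.pow_four, map_one]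
  mul_comm := by rw [← map_mul, h.mul_comm, map_smul, map_mul]
  mul_self := by rw [← map_mul, h.mul_self, map_smul, map_sub, map_mul, map_one]

theorem IsSkewPair.isKTuple {𝕜 A : Type*} [Field 𝕜] [Ring A] [Algebra 𝕜 A] {ξ : 𝕜}
    (hξ : IsPrimitiveRoot ξ 4) {a c : A} (h : IsSkewPair ξ 0 a c) :
    KAlg.IsKTuple ξ a (a ^ 2 * c) c (a ^ 3) := by
  have hξ₂ : ξ * ξ = -1 := KAlg.xi_mul_xi hξ
  have hac (w : A) : a * (c * w) = ξ • (c * (a * w)) := by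
    rw [← mul_assoc, h.mul_comm, smul_mul_assoc, mul_assoc]
  have hcc : c * c = 0 := by rw [h.mul_self, zero_smul]
  have hccw (w : A) : c * (c * w) = 0 := by rw [← mul_assoc, hcc, zero_mul]
  have ha : a * (a * (a * a)) = 1 := by rw [← h.pow_four]; noncomm_ring
  constructor
  case aaaa => exact h.pow_four
  all_goals simp [pow_succ, mul_assoc, h.mul_comm, hac, hcc, hccw, smul_smul, hξ₂, ha]

theorem ne_zero_of_sq_eq_two {𝕜 : Type*} [Field 𝕜] {ξ s : 𝕜} (hξ : IsPrimitiveRoot ξ 4)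
    (hs : s ^ 2 = 2) : s ≠ 0 := by
  rintro rfl
  exact two_ne_zero_of_isPrimitiveRoot_four hξ (by rw [← hs, zero_pow two_ne_zero])

namespace KAlg

variable {𝕜 A : Type*} [Field 𝕜] [Ring A] [Algebra 𝕜 A] {ξ : 𝕜} (hξ : IsPrimitiveRoot ξ 4)

/-- The algebra map out of the dual of `K` sending the generators `gDual, xDual` to a skew pair. -/
def liftDual {s : 𝕜} (hs : s ^ 2 = 2) {z y : A} (h : IsSkewPair (-1 : 𝕜) 1 z y) :
    Dual hξ →ₐ[𝕜] A :=
  have hs₀ : s ≠ 0 := ne_zero_of_sq_eq_two hξ hs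
  IsSkewPair.lift (dualBasis hξ hs₀) (coe_dualBasis hs₀) (isSkewPair_gDual_xDual hs) h
    (adjoin_gDual_xDual hs₀)

theorem liftDual_gDual {s : 𝕜} (hs : s ^ 2 = 2) {z y : A} (h : IsSkewPair (-1 : 𝕜) 1 z y) :
    liftDual hξ hs h (gDual hξ) = z := by
  rw [liftDual, IsSkewPair.lift_fst]

theorem liftDual_xDual {s : 𝕜} (hs : s ^ 2 = 2) {z y : A} (h : IsSkewPair (-1 : 𝕜) 1 z y) :
    liftDual hξ hs h (xDual hξ s) = y := by
  rw [liftDual, IsSkewPair.lift_snd]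

end KAlg

namespace DK

open KAlg (Dual gDual xDual)

variable {𝕜 : Type*} [Field 𝕜] {ξ : 𝕜} {hξ : IsPrimitiveRoot ξ 4} {s : 𝕜}

theorem isDTuple (hs : s ^ 2 = 2) : IsDTuple ξ s (a hξ) (c hξ) (g hξ) (x hξ s) where
  isSkewPair_a_c := KAlg.isSkewPair_a_c.map (inclK hξ)
  isSkewPair_g_x := (KAlg.isSkewPair_gDual_xDual hs).map (inclDual hξ)
  a_mul_g := a_mul_g
  c_mul_g := c_mul_g
  a_mul_x := a_mul_x s
  c_mul_x := c_mul_x s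

theorem adjoin_toCop :
    Algebra.adjoin 𝕜 {toCop 𝕜 _ (KAlg.a hξ), toCop 𝕜 _ (KAlg.c hξ)} = ⊤ :=
  KAlg.adjoin_a_c

theorem adjoin_gens (hs : s ≠ 0) :
    Algebra.adjoin 𝕜 {g hξ, x hξ s, a hξ, c hξ} = ⊤ := by
  have h := DrinfeldDouble.adjoin_union_eq_top (KAlg.adjoin_gDual_xDual (hξ := hξ) hs) adjoin_toCop
  rwa [Set.image_pair, Set.image_pair, Set.insert_union, Set.singleton_union] at h

theorem algHom_ext {B : Type*} [Semiring B] [Algebra 𝕜 B] (hs : s ≠ 0) {φ φ' : DK hξ →ₐ[𝕜] B}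
    (ha : φ (a hξ) = φ' (a hξ)) (hc : φ (c hξ) = φ' (c hξ)) (hg : φ (g hξ) = φ' (g hξ))
    (hx : φ (x hξ s) = φ' (x hξ s)) : φ = φ' := by
  refine AlgHom.ext_of_adjoin_eq_top (adjoin_gens hs) ?_
  rintro _ (rfl | rfl | rfl | rfl)
  exacts [hg, hx, ha, hc]

section lift

variable {A : Type*} [Ring A] [Algebra 𝕜 A] {a' c' g' x' : A}

open DrinfeldDouble in
theorem inclK_mul_inclDual_mem_mulSpan {t : KAlg hξ} (ht : t = KAlg.a hξ ∨ t = KAlg.c hξ)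
    {f : Dual hξ} (hf : f ∈ ({1, gDual hξ, xDual hξ s} : Set (Dual hξ))) :
    inclK hξ t * inclDual hξ f ∈ mulSpan (Cop 𝕜 (KAlg hξ)) {1, gDual hξ, xDual hξ s} := by
  set F : Set (Dual hξ) := {1, gDual hξ, xDual hξ s}
  set W := mulSpan (Cop 𝕜 (KAlg hξ)) F
  have one_mem (u) : inclK hξ u ∈ W := by
    have h : (1 : Dual hξ) ∈ F := .inl rfl
    have := inclDual_mul_inclH_mem_mulSpan h (toCop 𝕜 _ u)
    rwa [map_one, one_mul] at this
  have g_mem (u) : g hξ * inclK hξ u ∈ W :=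
    have h : gDual hξ ∈ F := .inr (.inl rfl)
    inclDual_mul_inclH_mem_mulSpan h (toCop 𝕜 _ u)
  have x_mem (u) : x hξ s * inclK hξ u ∈ W :=
    have h : xDual hξ s ∈ F := .inr (.inr rfl)
    inclDual_mul_inclH_mem_mulSpan h (toCop 𝕜 _ u)
  obtain rfl | rfl | rfl := hf
  · rw [map_one, mul_one]
    exact one_mem t
  · obtain rfl | rfl := ht
    · rw [inclDual_gDual, inclK_a, a_mul_g]
      exact g_mem (KAlg.a hξ)
    · rw [inclDual_gDual, inclK_c, c_mul_g]
      exact neg_mem (g_mem (KAlg.c hξ))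
  · obtain rfl | rfl := ht
    · rw [inclDual_xDual, inclK_a, a_mul_x, ← b_eq]
      exact add_mem (W.smul_mem _ (x_mem (KAlg.a hξ)))
        (W.smul_mem _ (add_mem (one_mem (KAlg.b hξ)) (g_mem (KAlg.c hξ))))
    · rw [inclDual_xDual, inclK_c, c_mul_x, ← d_eq]
      exact add_mem (W.smul_mem _ (x_mem (KAlg.c hξ)))
        (W.smul_mem _ (sub_mem (one_mem (KAlg.d hξ)) (g_mem (KAlg.a hξ))))

open DrinfeldDouble in
theorem liftLinear_inclK_mul_inclDual (h : IsDTuple ξ s a' c' g' x') {ψ : Dual hξ →ₐ[𝕜] A}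
    {φ : Cop 𝕜 (KAlg hξ) →ₐ[𝕜] A} (hg : ψ (gDual hξ) = g') (hx : ψ (xDual hξ s) = x')
    (ha : φ (toCop 𝕜 _ (KAlg.a hξ)) = a') (hc : φ (toCop 𝕜 _ (KAlg.c hξ)) = c') {t : KAlg hξ}
    (ht : t = KAlg.a hξ ∨ t = KAlg.c hξ) {f : Dual hξ}
    (hf : f ∈ ({1, gDual hξ, xDual hξ s} : Set (Dual hξ))) :
    liftLinear ψ φ (inclK hξ t * inclDual hξ f) = φ (toCop 𝕜 _ t) * ψ f := by
  have one_val (u) : liftLinear ψ φ (inclK hξ u) = φ (toCop 𝕜 _ u) :=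
    liftLinear_inclH ψ φ (toCop 𝕜 _ u)
  have g_val (u) : liftLinear ψ φ (g hξ * inclK hξ u) = g' * φ (toCop 𝕜 _ u) :=
    hg ▸ liftLinear_inclDual_mul_inclH ψ φ (gDual hξ) (toCop 𝕜 _ u)
  have x_val (u) : liftLinear ψ φ (x hξ s * inclK hξ u) = x' * φ (toCop 𝕜 _ u) :=
    hx ▸ liftLinear_inclDual_mul_inclH ψ φ (xDual hξ s) (toCop 𝕜 _ u)
  obtain rfl | rfl | rfl := hf
  · rw [map_one, map_one, mul_one, mul_one, one_val]
  · obtain rfl | rfl := ht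
    · rw [inclDual_gDual, inclK_a, a_mul_g, ← inclK_a, g_val, ha, hg, h.a_mul_g]
    · rw [inclDual_gDual, inclK_c, c_mul_g, map_neg, ← inclK_c, g_val, hc, hg, h.c_mul_g]
  · obtain rfl | rfl := ht
    · rw [inclDual_xDual, inclK_a, a_mul_x]
      simp only [← inclK_a, ← inclK_c, ← map_pow, ← map_mul, map_add, map_smul, x_val, one_val,
        g_val]
      simp only [map_mul, map_pow, ha, hc, hx, h.a_mul_x]
    · rw [inclDual_xDual, inclK_c, c_mul_x]
      simp only [← inclK_a, ← inclK_c, ← map_pow, map_add, map_sub, map_smul, x_val, one_val,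
        g_val]
      simp only [map_pow, ha, hc, hx, h.c_mul_x]

variable (hs : s ^ 2 = 2) (h : IsDTuple ξ s a' c' g' x')

variable (hξ) in
/-- The universal property of `D`: every tuple satisfying the relations of `IsDTuple` is the image
of `a, c, g, x` under an algebra map. -/
def lift : DK hξ →ₐ[𝕜] A :=
  DrinfeldDouble.lift (F := {1, gDual hξ, xDual hξ s}) (KAlg.liftDual hξ hs h.isSkewPair_g_x)
    ((KAlg.lift (h.isSkewPair_a_c.isKTuple hξ)).comp (toCop 𝕜 (KAlg hξ)).symm.toAlgHom) adjoin_toCop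
    (top_le_iff.1 ((KAlg.adjoin_gDual_xDual (ne_zero_of_sq_eq_two hξ hs)).ge.trans
      (Algebra.adjoin_mono (Set.subset_insert _ _))))
    (fun _ ht _ hf => inclK_mul_inclDual_mem_mulSpan ht hf)
    (fun _ ht _ hf => liftLinear_inclK_mul_inclDual h (KAlg.liftDual_gDual hξ hs h.isSkewPair_g_x)
      (KAlg.liftDual_xDual hξ hs h.isSkewPair_g_x) (KAlg.lift_a (h.isSkewPair_a_c.isKTuple hξ))
      (KAlg.lift_c (h.isSkewPair_a_c.isKTuple hξ)) ht hf)

theorem lift_a : lift hξ hs h (a hξ) = a' :=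
  (DrinfeldDouble.lift_inclH ..).trans (KAlg.lift_a (h.isSkewPair_a_c.isKTuple hξ))

theorem lift_c : lift hξ hs h (c hξ) = c' :=
  (DrinfeldDouble.lift_inclH ..).trans (KAlg.lift_c (h.isSkewPair_a_c.isKTuple hξ))

theorem lift_g : lift hξ hs h (g hξ) = g' :=
  (DrinfeldDouble.lift_inclDual ..).trans (KAlg.liftDual_gDual hξ hs h.isSkewPair_g_x)

theorem lift_x : lift hξ hs h (x hξ s) = x' :=
  (DrinfeldDouble.lift_inclDual ..).trans (KAlg.liftDual_xDual hξ hs h.isSkewPair_g_x)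

end lift

end DK

section xiPow

variable {𝕜 : Type*} [Field 𝕜] {ξ : 𝕜}

theorem xiPow_natCast (hξ : IsPrimitiveRoot ξ 4) (n : ℕ) : xiPow ξ n = ξ ^ n := by
  rw [xiPow, ZMod.val_natCast, ← pow_eq_pow_mod n hξ.pow_eq_one]

theorem xiPow_add (hξ : IsPrimitiveRoot ξ 4) (m n : ZMod 4) :
    xiPow ξ (m + n) = xiPow ξ m * xiPow ξ n := by
  rw [← ZMod.natCast_zmod_val m, ← ZMod.natCast_zmod_val n, ← Nat.cast_add, xiPow_natCast hξ,
    xiPow_natCast hξ, xiPow_natCast hξ, pow_add]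

theorem xiPow_zero : xiPow ξ 0 = 1 := pow_zero ξ

theorem xiPow_one : xiPow ξ 1 = ξ := pow_one ξ

theorem xiPow_two (hξ : IsPrimitiveRoot ξ 4) : xiPow ξ 2 = -1 :=
  (sq ξ).trans (KAlg.xi_mul_xi hξ)

theorem xiPow_three (hξ : IsPrimitiveRoot ξ 4) : xiPow ξ 3 = -ξ := by
  rw [show (3 : ZMod 4) = 2 + 1 from rfl, xiPow_add hξ, xiPow_two hξ, xiPow_one, neg_one_mul]

theorem xiPow_three_mul (hξ : IsPrimitiveRoot ξ 4) (i : ZMod 4) :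
    xiPow ξ (3 * i) = xiPow ξ i ^ 3 := by
  rw [show 3 * i = i + i + i by ring, xiPow_add hξ, xiPow_add hξ, pow_three']

theorem xiPow_two_mul (hξ : IsPrimitiveRoot ξ 4) (i : ZMod 4) :
    xiPow ξ (2 * i) = xiPow ξ i ^ 2 := by
  rw [two_mul, xiPow_add hξ, sq]

theorem xiPow_neg (hξ : IsPrimitiveRoot ξ 4) (i : ZMod 4) : xiPow ξ (-i) = xiPow ξ i ^ 3 := by
  rw [← xiPow_three_mul hξ, show -i = 3 * i by revert i; decide]

theorem xiPow_pow_four (hξ : IsPrimitiveRoot ξ 4) (i : ZMod 4) : xiPow ξ i ^ 4 = 1 := by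
  rw [xiPow, pow_right_comm, hξ.pow_eq_one, one_pow]

theorem neg_one_pow_val (hξ : IsPrimitiveRoot ξ 4) (i : ZMod 4) :
    (-1 : 𝕜) ^ i.val = xiPow ξ i ^ 2 := by
  rw [xiPow, ← KAlg.xi_mul_xi hξ, ← sq, pow_right_comm]

theorem xiPow_injective (hξ : IsPrimitiveRoot ξ 4) : Function.Injective (xiPow ξ) :=
  fun i j h => ZMod.val_injective 4 (hξ.pow_inj (ZMod.val_lt i) (ZMod.val_lt j) h)

end xiPow

namespace IsDTuple

variable {𝕜 : Type*} [Field 𝕜] {ξ : 𝕜} (hξ : IsPrimitiveRoot ξ 4) {s : 𝕜}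

include hξ

theorem char (s : 𝕜) (j : ZMod 4) : IsDTuple ξ s (xiPow ξ j) 0 ((-1) ^ j.val) 0 := by
  have hj := xiPow_pow_four hξ j
  rw [neg_one_pow_val hξ]
  refine ⟨⟨hj, ?_, ?_⟩, ⟨?_, ?_, ?_⟩, ?_, ?_, ?_, ?_⟩ <;>
    (try simp only [smul_eq_mul]) <;> grind

theorem matrix (hs : s ^ 2 = 2) (i j : ZMod 4) :
    IsDTuple ξ s !![xiPow ξ i, 0; 0, xiPow ξ (i + 3)] !![0, 1; 0, 0]
      !![xiPow ξ j, 0; 0, xiPow ξ (j + 2)]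
      !![0, s / 2 * ξ * (xiPow ξ i + xiPow ξ (3 * i + j));
        s * ξ * (xiPow ξ (3 * i) - xiPow ξ (i + j)), 0] := by
  have hx : ξ * ξ = -1 := KAlg.xi_mul_xi hξ
  have hi := xiPow_pow_four hξ i
  have hj := xiPow_pow_four hξ j
  have h2 := two_ne_zero_of_isPrimitiveRoot_four hξ
  simp only [xiPow_add hξ, xiPow_two hξ, xiPow_three hξ, xiPow_three_mul hξ]
  refine ⟨⟨?_, ?_, ?_⟩, ⟨?_, ?_, ?_⟩, ?_, ?_, ?_, ?_⟩ <;> ext p q <;> fin_cases p <;>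
    fin_cases q <;> simp [pow_succ, Matrix.mul_apply, Fin.sum_univ_two] <;> grind

end IsDTuple

namespace DK

variable {𝕜 : Type*} [Field 𝕜] {ξ : 𝕜} (hξ : IsPrimitiveRoot ξ 4) {s : 𝕜}

/-- The character `χ^j` of `D`. -/
def character (hs : s ^ 2 = 2) (j : ZMod 4) : DK hξ →ₐ[𝕜] 𝕜 :=
  lift hξ hs (IsDTuple.char hξ s j)

/-- The matrix representation `ρ_{i,j}` of `D`; it exists for all `i` and `j`. -/
def matrixRep (hs : s ^ 2 = 2) (i j : ZMod 4) : DK hξ →ₐ[𝕜] Matrix (Fin 2) (Fin 2) 𝕜 :=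
  lift hξ hs (IsDTuple.matrix hξ hs i j)

theorem hasCharValues_character (hs : s ^ 2 = 2) (j : ZMod 4) :
    HasCharValues hξ s j (character hξ hs j) where
  a := lift_a ..
  b := by rw [b_eq, map_mul, character, lift_c, mul_zero]
  c := lift_c ..
  d := by rw [d_eq, map_pow, character, lift_a, xiPow_neg hξ]
  x := lift_x ..
  g := lift_g ..

theorem hasMatrixValues_matrixRep (hs : s ^ 2 = 2) (i j : ZMod 4) :
    HasMatrixValues hξ s i j (matrixRep hξ hs i j) where
  a := lift_a ..
  b := by
    rw [b_eq, map_mul, map_pow, matrixRep, lift_a, lift_c, neg_one_pow_val hξ]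
    simp [sq]
  c := lift_c ..
  d := by
    rw [d_eq, map_pow, matrixRep, lift_a, xiPow_neg hξ, xiPow_add hξ, xiPow_add hξ, xiPow_neg hξ,
      xiPow_one, xiPow_three hξ]
    simp [pow_three]
    grind [KAlg.xi_mul_xi hξ]
  g := lift_g ..
  x := lift_x ..

theorem hasCharValues_iff (hs : s ^ 2 = 2) {j : ZMod 4} {φ : DK hξ →ₐ[𝕜] 𝕜} :
    HasCharValues hξ s j φ ↔ φ = character hξ hs j := by
  have h₀ := hasCharValues_character hξ hs j
  refine ⟨fun h => ?_, fun h => h ▸ h₀⟩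
  exact algHom_ext (ne_zero_of_sq_eq_two hξ hs) (h.a.trans h₀.a.symm) (h.c.trans h₀.c.symm)
    (h.g.trans h₀.g.symm) (h.x.trans h₀.x.symm)

theorem hasMatrixValues_iff (hs : s ^ 2 = 2) {i j : ZMod 4}
    {φ : DK hξ →ₐ[𝕜] Matrix (Fin 2) (Fin 2) 𝕜} :
    HasMatrixValues hξ s i j φ ↔ φ = matrixRep hξ hs i j := by
  have h₀ := hasMatrixValues_matrixRep hξ hs i j
  refine ⟨fun h => ?_, fun h => h ▸ h₀⟩
  exact algHom_ext (ne_zero_of_sq_eq_two hξ hs) (h.a.trans h₀.a.symm) (h.c.trans h₀.c.symm)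
    (h.g.trans h₀.g.symm) (h.x.trans h₀.x.symm)

end DK

theorem exists_inf_eigenspace_ne_bot {𝕜 V : Type*} [Field 𝕜] {ξ : 𝕜} (hξ : IsPrimitiveRoot ξ 4)
    [AddCommGroup V] [Module 𝕜 V] {T : Module.End 𝕜 V} (hT : T ^ 4 = 1) {S : Submodule 𝕜 V}
    (hTS : ∀ v ∈ S, T v ∈ S) (hS : S ≠ ⊥) :
    ∃ i, S ⊓ T.eigenspace (xiPow ξ i) ≠ ⊥ := by
  by_contra! H
  obtain ⟨v, hv, hv0⟩ := S.ne_bot_iff.1 hS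
  have step (i : ZMod 4) {w : V} (hw : w ∈ S ∧ w ≠ 0) :
      T w - xiPow ξ i • w ∈ S ∧ T w - xiPow ξ i • w ≠ 0 := by
    refine ⟨S.sub_mem (hTS w hw.1) (S.smul_mem _ hw.1), fun h => hw.2 ?_⟩
    exact (Submodule.eq_bot_iff _).1 (H i) w
      ⟨hw.1, Module.End.mem_eigenspace_iff.2 (sub_eq_zero.1 h)⟩
  have hT4 : T (T (T (T v))) = v := LinearMap.congr_fun hT v
  -- `T⁴ - 1` is the product of the `T - ξ ^ i`.
  refine (step 3 (step 2 (step 1 (step 0 ⟨hv, hv0⟩)))).2 ?_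
  have hx := KAlg.xi_mul_xi hξ
  simp only [xiPow_zero, xiPow_one, xiPow_two hξ, xiPow_three hξ, map_sub, map_smul, hT4]
  match_scalars <;> grind

namespace DK

variable {𝕜 : Type*} [Field 𝕜] {ξ : 𝕜}

/-- The scalar by which `c * x` acts on a vector of highest weight `(i, j)`. -/
def cxScalar (ξ s : 𝕜) (i j : ZMod 4) : 𝕜 := s * ξ * (xiPow ξ (3 * i) - xiPow ξ (i + j))

theorem cxScalar_eq_zero_iff (hξ : IsPrimitiveRoot ξ 4) {s : 𝕜} (hs : s ^ 2 = 2) {i j : ZMod 4} :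
    cxScalar ξ s i j = 0 ↔ 2 * i = j := by
  have hsξ : s * ξ ≠ 0 := mul_ne_zero (ne_zero_of_sq_eq_two hξ hs) (hξ.ne_zero four_ne_zero)
  rw [cxScalar, mul_eq_zero_iff_left hsξ, sub_eq_zero, (xiPow_injective hξ).eq_iff,
    show 3 * i = i + 2 * i by ring, add_right_inj]

variable {hξ : IsPrimitiveRoot ξ 4} {M : Type*} [AddCommGroup M] [Module 𝕜 M] [Module (DK hξ) M]

variable (hξ) in
/-- A vector killed by `c` on which `a` and `g` act by `ξ ^ i` and `ξ ^ j`; it is allowed to be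
zero. -/
structure IsHighestWeight (i j : ZMod 4) (v : M) : Prop where
  c : c hξ • v = 0
  a : a hξ • v = xiPow ξ i • v
  g : g hξ • v = xiPow ξ j • v

namespace IsHighestWeight

variable {i j : ZMod 4} {v : M}

theorem weight_eq {i' j' : ZMod 4} (hv : IsHighestWeight hξ i j v)
    (hv' : IsHighestWeight hξ i' j' v) (hv0 : v ≠ 0) : (i, j) = (i', j') :=
  Prod.ext (xiPow_injective hξ (smul_left_injective 𝕜 hv0 (hv.a.symm.trans hv'.a)))
    (xiPow_injective hξ (smul_left_injective 𝕜 hv0 (hv.g.symm.trans hv'.g)))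

theorem prod {N : Type*} [AddCommGroup N] [Module 𝕜 N] [Module (DK hξ) N] {w : N}
    (hv : IsHighestWeight hξ i j v) (hw : IsHighestWeight hξ i j w) :
    IsHighestWeight hξ i j (v, w) :=
  ⟨Prod.ext hv.c hw.c, Prod.ext hv.a hw.a, Prod.ext hv.g hw.g⟩

variable [IsScalarTower 𝕜 (DK hξ) M]

theorem smul (hv : IsHighestWeight hξ i j v) (r : 𝕜) : IsHighestWeight hξ i j (r • v) :=
  ⟨by rw [smul_comm, hv.c, smul_zero], by rw [smul_comm, hv.a, smul_comm],
    by rw [smul_comm, hv.g, smul_comm]⟩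

theorem map {N : Type*} [AddCommGroup N] [Module 𝕜 N] [Module (DK hξ) N]
    [IsScalarTower 𝕜 (DK hξ) N] (hv : IsHighestWeight hξ i j v) (f : M →ₗ[DK hξ] N) :
    IsHighestWeight hξ i j (f v) :=
  ⟨by rw [← map_smul, hv.c, map_zero], by rw [← map_smul, hv.a, f.map_smul_of_tower],
    by rw [← map_smul, hv.g, f.map_smul_of_tower]⟩

theorem a_pow_smul (hv : IsHighestWeight hξ i j v) (n : ℕ) :
    DK.a hξ ^ n • v = xiPow ξ i ^ n • v := by
  induction n with
  | zero => simp only [pow_zero, one_smul]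
  | succ n ih => rw [pow_succ, mul_smul, hv.a, smul_comm, ih, smul_smul, pow_succ']

section

variable {s : 𝕜} (hs : s ^ 2 = 2) (hv : IsHighestWeight hξ i j v)

include hs hv

theorem a_smul_x_smul : DK.a hξ • x hξ s • v = xiPow ξ (i + 3) • x hξ s • v := by
  rw [smul_smul, (isDTuple hs).a_mul_x, xiPow_add hξ, xiPow_three hξ]
  simp only [add_smul, smul_assoc, mul_smul (α := DK hξ), hv.c, hv.a, smul_zero, add_zero]
  rw [smul_comm (x hξ s), smul_smul, mul_comm]

theorem g_smul_x_smul : DK.g hξ • x hξ s • v = xiPow ξ (j + 2) • x hξ s • v := by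
  rw [smul_smul, (isDTuple hs).isSkewPair_g_x.mul_comm, smul_assoc, mul_smul, hv.g,
    smul_comm (x hξ s), smul_smul, xiPow_add hξ, xiPow_two hξ, mul_comm]

theorem c_smul_x_smul : DK.c hξ • x hξ s • v = cxScalar ξ s i j • v := by
  rw [smul_smul, (isDTuple hs).c_mul_x, cxScalar, xiPow_three_mul hξ, xiPow_add hξ]
  simp only [add_smul, sub_smul, smul_assoc, mul_smul (α := DK hξ), hv.c, hv.a, hv.a_pow_smul,
    smul_zero, zero_add, smul_comm (DK.g hξ) (_ : 𝕜), hv.g]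
  module

theorem x_smul_x_smul : x hξ s • x hξ s • v = (xiPow ξ (2 * j) - 1) • v := by
  rw [smul_smul, (isDTuple hs).isSkewPair_g_x.mul_self, one_smul, sub_smul, mul_smul, hv.g,
    smul_comm, hv.g, smul_smul, one_smul, xiPow_two_mul hξ, sq, sub_smul, one_smul]

theorem smul_mem_span_pair (z : DK hξ) :
    ∀ w ∈ Submodule.span 𝕜 {v, x hξ s • v}, z • w ∈ Submodule.span 𝕜 {v, x hξ s • v} := by
  set S := Submodule.span 𝕜 {v, x hξ s • v}
  have mem_v : v ∈ S := Submodule.subset_span (.inl rfl)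
  have mem_x : x hξ s • v ∈ S := Submodule.subset_span (.inr rfl)
  have stable {t : DK hξ} (h₁ : t • v ∈ S) (h₂ : t • x hξ s • v ∈ S) : ∀ w ∈ S, t • w ∈ S :=
    (Submodule.span_le (p := S.comap (Algebra.lsmul 𝕜 𝕜 M t))).2
      (Set.insert_subset h₁ (Set.singleton_subset_iff.2 h₂))
  refine smul_mem_of_adjoin_eq_top (adjoin_gens (ne_zero_of_sq_eq_two hξ hs)) ?_ z
  rintro t (rfl | rfl | rfl | rfl)
  · exact stable (hv.g ▸ S.smul_mem _ mem_v) (hv.g_smul_x_smul hs ▸ S.smul_mem _ mem_x)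
  · exact stable mem_x (hv.x_smul_x_smul hs ▸ S.smul_mem _ mem_v)
  · exact stable (hv.a ▸ S.smul_mem _ mem_v) (hv.a_smul_x_smul hs ▸ S.smul_mem _ mem_x)
  · exact stable (hv.c ▸ S.zero_mem) (hv.c_smul_x_smul hs ▸ S.smul_mem _ mem_v)

theorem exists_smul_eq (z : DK hξ) : ∃ p q : 𝕜, z • v = p • v + q • x hξ s • v := by
  obtain ⟨p, q, h⟩ := Submodule.mem_span_pair.1
    (hv.smul_mem_span_pair hs z v (Submodule.subset_span (.inl rfl)))
  exact ⟨p, q, h.symm⟩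

theorem c_smul_add (p q : 𝕜) :
    DK.c hξ • (p • v + q • x hξ s • v) = (q * cxScalar ξ s i j) • v := by
  rw [smul_add, smul_comm, hv.c, smul_zero, zero_add, smul_comm, hv.c_smul_x_smul hs, smul_smul]

theorem x_smul_eq_zero [IsSimpleModule (DK hξ) M] (hij : 2 * i = j) : x hξ s • v = 0 := by
  by_contra hx0
  have hv0 : v ≠ 0 := fun h => hx0 (by rw [h, smul_zero])
  have hxx : x hξ s • x hξ s • v = 0 := by
    rw [hv.x_smul_x_smul hs, ← hij, xiPow_two_mul hξ, xiPow_two_mul hξ, ← pow_mul,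
      xiPow_pow_four hξ, sub_self, zero_smul]
  have hxv : IsHighestWeight hξ (i + 3) (j + 2) (x hξ s • v) :=
    ⟨by rw [hv.c_smul_x_smul hs, (cxScalar_eq_zero_iff hξ hs).2 hij, zero_smul],
      hv.a_smul_x_smul hs, hv.g_smul_x_smul hs⟩
  -- By simplicity `v` is a multiple of `x • v`, whose weight is different.
  obtain ⟨z, hz⟩ := IsSimpleModule.toSpanSingleton_surjective (DK hξ) hx0 v
  obtain ⟨p, q, h⟩ := hxv.exists_smul_eq hs z
  rw [hxx, smul_zero, add_zero, ← LinearMap.toSpanSingleton_apply, hz] at h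
  have hw := hv.weight_eq (h.symm ▸ hxv.smul p) hv0
  exact absurd (left_eq_add.1 (congr_arg Prod.fst hw)) (by decide)

variable [IsSimpleModule (DK hξ) M] (hv0 : v ≠ 0)

include hv0

theorem exists_eq_smul {w : M} (hw : DK.c hξ • w = 0) : ∃ r : 𝕜, w = r • v := by
  obtain ⟨z, rfl⟩ := IsSimpleModule.toSpanSingleton_surjective (DK hξ) hv0 w
  obtain ⟨p, q, h⟩ := hv.exists_smul_eq hs z
  rw [LinearMap.toSpanSingleton_apply, h] at hw ⊢
  refine ⟨p, add_eq_left.2 ?_⟩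
  rw [hv.c_smul_add hs, smul_eq_zero_iff_left hv0, mul_eq_zero, cxScalar_eq_zero_iff hξ hs] at hw
  rcases hw with rfl | hij
  · rw [zero_smul]
  · rw [hv.x_smul_eq_zero hs hij, smul_zero]

theorem smul_add_smul_x_smul_eq_zero_iff {p q : 𝕜} :
    p • v + q • x hξ s • v = 0 ↔ p = 0 ∧ (q = 0 ∨ 2 * i = j) := by
  have q_smul (h : q = 0 ∨ 2 * i = j) : q • x hξ s • v = 0 := by
    rcases h with rfl | hij
    · rw [zero_smul]
    · rw [hv.x_smul_eq_zero hs hij, smul_zero]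
  refine ⟨fun h => ?_, fun h => by rw [h.1, q_smul h.2, zero_smul, add_zero]⟩
  have hc := hv.c_smul_add hs p q
  rw [h, smul_zero, eq_comm, smul_eq_zero_iff_left hv0, mul_eq_zero, cxScalar_eq_zero_iff hξ hs]
    at hc
  rw [q_smul hc, add_zero, smul_eq_zero_iff_left hv0] at h
  exact ⟨h, hc⟩

theorem nonempty_linearEquiv {N : Type*} [AddCommGroup N] [Module 𝕜 N] [Module (DK hξ) N]
    [IsScalarTower 𝕜 (DK hξ) N] [IsSimpleModule (DK hξ) N] {w : N}
    (hw : IsHighestWeight hξ i j w) (hw0 : w ≠ 0) : Nonempty (M ≃ₗ[DK hξ] N) := by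
  refine nonempty_linearEquiv_of_smul_eq_zero_iff hv0 hw0 fun z => ?_
  -- Working in `M × N` yields the same coefficients for `v` and for `w`.
  obtain ⟨p, q, h⟩ := (hv.prod hw).exists_smul_eq hs z
  have hzv : z • v = p • v + q • x hξ s • v := congr_arg Prod.fst h
  have hzw : z • w = p • w + q • x hξ s • w := congr_arg Prod.snd h
  rw [hzv, hzw, hv.smul_add_smul_x_smul_eq_zero_iff hs hv0,
    hw.smul_add_smul_x_smul_eq_zero_iff hs hw0]

end

end IsHighestWeight

variable [IsScalarTower 𝕜 (DK hξ) M]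

theorem exists_isHighestWeight [Nontrivial M] {s : 𝕜} (hs : s ^ 2 = 2) :
    ∃ i j, ∃ v : M, v ≠ 0 ∧ IsHighestWeight hξ i j v := by
  have hD := isDTuple (hξ := hξ) hs
  let T : DK hξ →ₐ[𝕜] Module.End 𝕜 M := Algebra.lsmul 𝕜 𝕜 M
  let S := LinearMap.ker (T (c hξ))
  have hS : S ≠ ⊥ := by
    obtain ⟨w, hw⟩ := exists_ne (0 : M)
    refine fun h => hw ?_
    have inj : Function.Injective (T (c hξ)) := LinearMap.ker_eq_bot.1 h
    refine inj (inj ?_)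
    rw [← Module.End.mul_apply, ← map_mul, hD.isSkewPair_a_c.mul_self, zero_smul]
    simp only [map_zero, LinearMap.zero_apply]
  have a_mem (v : M) (hv : c hξ • v = 0) : c hξ • a hξ • v = 0 := by
    refine (smul_eq_zero_iff_right (hξ.ne_zero four_ne_zero)).1 ?_
    rw [smul_smul, ← smul_assoc, ← hD.isSkewPair_a_c.mul_comm, mul_smul, hv, smul_zero]
  have g_mem (v : M) (hv : c hξ • v = 0) : c hξ • g hξ • v = 0 := by
    rw [smul_smul, hD.c_mul_g, neg_smul, mul_smul, hv, smul_zero, neg_zero]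
  have hTa : T (a hξ) ^ 4 = 1 := by rw [← map_pow, hD.isSkewPair_a_c.pow_four, map_one]
  have hTg : T (g hξ) ^ 4 = 1 := by rw [← map_pow, hD.isSkewPair_g_x.pow_four, map_one]
  have comm : Commute (T (a hξ)) (T (g hξ)) := Commute.map hD.a_mul_g T
  obtain ⟨i, hi⟩ := exists_inf_eigenspace_ne_bot hξ hTa a_mem hS
  obtain ⟨j, hj⟩ := exists_inf_eigenspace_ne_bot hξ hTg (fun v hv =>
    Submodule.mem_inf.2
      ⟨g_mem v hv.1, Module.End.mapsTo_genEigenspace_of_comm comm _ _ hv.2⟩) hi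
  obtain ⟨v, ⟨⟨hc, ha⟩, hg⟩, hv0⟩ := (Submodule.ne_bot_iff _).1 hj
  exact ⟨i, j, v, hv0, hc, Module.End.mem_eigenspace_iff.1 ha, Module.End.mem_eigenspace_iff.1 hg⟩

end DK

namespace RepModule

variable {𝕜 A V : Type*} [Field 𝕜] [Ring A] [Algebra 𝕜 A] [AddCommGroup V] [Module 𝕜 V]

/-- The identity map of `V`, as a map onto the module of a representation on `V`. -/
def mk (φ : A →ₐ[𝕜] Module.End 𝕜 V) : V ≃ₗ[𝕜] RepModule φ := LinearEquiv.refl 𝕜 V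

theorem smul_mk (φ : A →ₐ[𝕜] Module.End 𝕜 V) (z : A) (v : V) : z • mk φ v = mk φ (φ z v) := rfl

end RepModule

theorem natCard_lam : Nat.card Lam = 12 := by
  rw [Nat.card_eq_fintype_card]; decide

namespace DK

section Modules

variable {𝕜 : Type*} [Field 𝕜] {ξ : 𝕜} {hξ : IsPrimitiveRoot ξ 4} {s : 𝕜} {i j : ZMod 4}
  {χ : DK hξ →ₐ[𝕜] 𝕜} {ρ : DK hξ →ₐ[𝕜] Matrix (Fin 2) (Fin 2) 𝕜}

variable (χ) in
/-- The basis vector `1` of the module of a character. -/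
def charVec : CharModule χ := RepModule.mk _ (1 : 𝕜)

variable (ρ) in
/-- The column `(v₀, v₁)` as a vector of the module of a matrix representation. -/
def matVec (v₀ v₁ : 𝕜) : MatModule ρ := RepModule.mk _ ![v₀, v₁]

theorem smul_charVec (z : DK hξ) : z • charVec χ = χ z • charVec χ := by
  rw [charVec, RepModule.smul_mk, ← map_smul]
  rfl

theorem smul_matVec (z : DK hξ) (v₀ v₁ : 𝕜) : z • matVec ρ v₀ v₁ =
    matVec ρ (ρ z 0 0 * v₀ + ρ z 0 1 * v₁) (ρ z 1 0 * v₀ + ρ z 1 1 * v₁) := by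
  rw [matVec, RepModule.smul_mk, matVec]
  congr 1
  ext k
  fin_cases k <;> simp [Matrix.mulVec, dotProduct]

theorem charVec_ne_zero : charVec χ ≠ 0 := (RepModule.mk _).map_ne_zero_iff.2 one_ne_zero

theorem matVec_eq_zero_iff {v₀ v₁ : 𝕜} : matVec ρ v₀ v₁ = 0 ↔ v₀ = 0 ∧ v₁ = 0 := by
  rw [matVec, LinearEquiv.map_eq_zero_iff]
  simp

theorem exists_eq_matVec (w : MatModule ρ) : ∃ w₀ w₁, w = matVec ρ w₀ w₁ := by
  obtain ⟨w, rfl⟩ := (RepModule.mk _).surjective w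
  refine ⟨w 0, w 1, ?_⟩
  rw [matVec]
  congr
  ext k; fin_cases k <;> rfl

theorem isHighestWeight_charVec (h : HasCharValues hξ s j χ) :
    IsHighestWeight hξ j (2 * j) (charVec χ) where
  c := by rw [smul_charVec, h.c, zero_smul]
  a := by rw [smul_charVec, h.a]
  g := by rw [smul_charVec, h.g, neg_one_pow_val hξ, xiPow_two_mul hξ]

theorem isHighestWeight_matVec (h : HasMatrixValues hξ s i j ρ) :
    IsHighestWeight hξ i j (matVec ρ 1 0) where
  c := by rw [smul_matVec, h.c]; simp [matVec]
  a := by rw [smul_matVec, h.a, matVec, matVec, ← map_smul]; simp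
  g := by rw [smul_matVec, h.g, matVec, matVec, ← map_smul]; simp

theorem isSimpleModule_charModule : IsSimpleModule (DK hξ) (CharModule χ) := by
  have smul_eq (r : 𝕜) (w : 𝕜) : algebraMap 𝕜 (DK hξ) r • RepModule.mk _ w =
    (RepModule.mk _ (r * w) : CharModule χ) := by rw [algebraMap_smul, ← map_smul, smul_eq_mul]
  refine isSimpleModule_of_forall_exists_smul_eq charVec_ne_zero (fun w => ?_) fun w hw => ?_
  all_goals obtain ⟨w, rfl⟩ := (RepModule.mk _).surjective w
  · exact ⟨algebraMap 𝕜 _ w, by rw [charVec, smul_eq, mul_one]⟩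
  · have hw₀ : w ≠ 0 := (RepModule.mk _).map_ne_zero_iff.1 hw
    exact ⟨algebraMap 𝕜 _ w⁻¹, by rw [smul_eq, inv_mul_cancel₀ hw₀, charVec]⟩

theorem isSimpleModule_matModule (hs : s ^ 2 = 2) (hij : 2 * i ≠ j)
    (h : HasMatrixValues hξ s i j ρ) : IsSimpleModule (DK hξ) (MatModule ρ) := by
  have hκ : cxScalar ξ s i j ≠ 0 := (cxScalar_eq_zero_iff hξ hs).not.2 hij
  refine isSimpleModule_of_forall_exists_smul_eq (v := matVec ρ 1 0)
    (matVec_eq_zero_iff.not.2 fun h => one_ne_zero h.1) (fun w => ?_) fun w hw => ?_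
  all_goals obtain ⟨w₀, w₁, rfl⟩ := exists_eq_matVec w
  · refine ⟨algebraMap 𝕜 _ w₀ + (w₁ / cxScalar ξ s i j) • x hξ s, ?_⟩
    rw [smul_matVec, map_add, map_smul, h.x, AlgHom.commutes, ← cxScalar]
    simp [Matrix.algebraMap_matrix_apply, hκ]
  · by_cases hw₁ : w₁ = 0
    · have hw₀ : w₀ ≠ 0 := fun hw₀ => hw (matVec_eq_zero_iff.2 ⟨hw₀, hw₁⟩)
      refine ⟨algebraMap 𝕜 _ w₀⁻¹, ?_⟩
      rw [smul_matVec, AlgHom.commutes]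
      simp [Matrix.algebraMap_matrix_apply, hw₀, hw₁]
    · refine ⟨w₁⁻¹ • c hξ, ?_⟩
      rw [smul_matVec, map_smul, h.c]
      simp [hw₁]

end Modules

/-- The highest weights of the modules in `simpleFamily`. -/
def weight : ZMod 4 ⊕ Lam → ZMod 4 × ZMod 4
  | .inl j => (j, 2 * j)
  | .inr p => p.1

theorem weight_bijective : Function.Bijective weight := by
  constructor
  · rintro (i | ⟨p, hp⟩) (j | ⟨q, hq⟩) h
    · exact congr_arg _ (Prod.ext_iff.1 h).1
    · obtain rfl : (i, 2 * i) = q := h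
      exact absurd rfl hq
    · obtain rfl : p = (j, 2 * j) := h
      exact absurd rfl hp
    · obtain rfl : p = q := h
      rfl
  · rintro ⟨i, j⟩
    by_cases h : 2 * i = j
    · exact ⟨.inl i, Prod.ext rfl h⟩
    · exact ⟨.inr ⟨(i, j), h⟩, rfl⟩

section Family

variable {𝕜 : Type u} [Field 𝕜] {ξ : 𝕜} {hξ : IsPrimitiveRoot ξ 4} {s : 𝕜}
  {χ : ZMod 4 → (DK hξ →ₐ[𝕜] 𝕜)} {ρ : Lam → (DK hξ →ₐ[𝕜] Matrix (Fin 2) (Fin 2) 𝕜)}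

instance (t : ZMod 4 ⊕ Lam) : Module 𝕜 (simpleFamily hξ χ ρ t) :=
  match t with
  | .inl j => inferInstanceAs (Module 𝕜 (CharModule (χ j)))
  | .inr p => inferInstanceAs (Module 𝕜 (MatModule (ρ p)))

instance (t : ZMod 4 ⊕ Lam) : IsScalarTower 𝕜 (DK hξ) (simpleFamily hξ χ ρ t) :=
  match t with
  | .inl j => inferInstanceAs (IsScalarTower 𝕜 (DK hξ) (CharModule (χ j)))
  | .inr p => inferInstanceAs (IsScalarTower 𝕜 (DK hξ) (MatModule (ρ p)))

variable (hs : s ^ 2 = 2) (hχ : ∀ j, HasCharValues hξ s j (χ j))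
  (hρ : ∀ p : Lam, HasMatrixValues hξ s p.1.1 p.1.2 (ρ p))

include hχ hρ in
theorem exists_isHighestWeight_simpleFamily (t : ZMod 4 ⊕ Lam) :
    ∃ v : simpleFamily hξ χ ρ t, v ≠ 0 ∧ IsHighestWeight hξ (weight t).1 (weight t).2 v :=
  match t with
  | .inl j => ⟨charVec (χ j), charVec_ne_zero, isHighestWeight_charVec (hχ j)⟩
  | .inr p => ⟨matVec (ρ p) 1 0, matVec_eq_zero_iff.not.2 fun h => one_ne_zero h.1,
      isHighestWeight_matVec (hρ p)⟩

include hs hρ in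
theorem isSimpleModule_simpleFamily (t : ZMod 4 ⊕ Lam) :
    IsSimpleModule (DK hξ) (simpleFamily hξ χ ρ t) :=
  match t with
  | .inl _ => isSimpleModule_charModule
  | .inr p => isSimpleModule_matModule hs p.2 (hρ p)

include hs hχ hρ

theorem eq_of_linearEquiv_simpleFamily {t t' : ZMod 4 ⊕ Lam}
    (e : simpleFamily hξ χ ρ t ≃ₗ[DK hξ] simpleFamily hξ χ ρ t') : t = t' := by
  obtain ⟨v, hv0, hv⟩ := exists_isHighestWeight_simpleFamily hχ hρ t
  obtain ⟨v', hv0', hv'⟩ := exists_isHighestWeight_simpleFamily hχ hρ t'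
  have := isSimpleModule_simpleFamily (χ := χ) hs hρ t'
  have hev := hv.map e.toLinearMap
  obtain ⟨r, hr⟩ := hv'.exists_eq_smul hs hv0' hev.c
  exact weight_bijective.1 (hev.weight_eq (hr ▸ hv'.smul r) (e.map_ne_zero_iff.2 hv0))

theorem exists_linearEquiv_simpleFamily (M : Type v) [AddCommGroup M] [Module (DK hξ) M]
    [IsSimpleModule (DK hξ) M] : ∃ t, Nonempty (M ≃ₗ[DK hξ] simpleFamily hξ χ ρ t) := by
  let _ : Module 𝕜 M := Module.compHom M (algebraMap 𝕜 (DK hξ))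
  have : IsScalarTower 𝕜 (DK hξ) M := IsScalarTower.of_algebraMap_smul fun _ _ => rfl
  have := IsSimpleModule.nontrivial (DK hξ) M
  obtain ⟨i, j, v, hv0, hv⟩ := exists_isHighestWeight (hξ := hξ) (M := M) hs
  obtain ⟨t, ht⟩ := weight_bijective.2 (i, j)
  obtain ⟨w, hw0, hw⟩ := exists_isHighestWeight_simpleFamily hχ hρ t
  have := isSimpleModule_simpleFamily (χ := χ) hs hρ t
  rw [ht] at hw
  exact ⟨t, hv.nonempty_linearEquiv hs hv0 hw hw0⟩

end Family

end DK

theorem mainTheorem3_general {𝕜 : Type u} [Field 𝕜] {ξ : 𝕜} (hξ : IsPrimitiveRoot ξ 4) {s : 𝕜}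
    (hs : s ^ 2 = 2) :
    Module.finrank 𝕜 (DK hξ) = 64 ∧
    ∃ (χ : ZMod 4 → (DK hξ →ₐ[𝕜] 𝕜)) (ρ : Lam → (DK hξ →ₐ[𝕜] Matrix (Fin 2) (Fin 2) 𝕜)),
      (∀ j φ, HasCharValues hξ s j φ ↔ φ = χ j) ∧
      (∀ p φ, HasMatrixValues hξ s p.1.1 p.1.2 φ ↔ φ = ρ p) ∧
      (∀ j, Module.finrank 𝕜 (CharModule (χ j)) = 1) ∧
      (∀ p, Module.finrank 𝕜 (MatModule (ρ p)) = 2) ∧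
      Nat.card (ZMod 4) = 4 ∧ Nat.card Lam = 12 ∧ Nat.card (ZMod 4 ⊕ Lam) = 16 ∧
      (∀ t, IsSimpleModule (DK hξ) (simpleFamily hξ χ ρ t)) ∧
      (∀ t t', Nonempty (simpleFamily hξ χ ρ t ≃ₗ[DK hξ] simpleFamily hξ χ ρ t') → t = t') ∧
      (∀ (M : Type v) [AddCommGroup M] [Module (DK hξ) M], IsSimpleModule (DK hξ) M →
        ∃ t, Nonempty (M ≃ₗ[DK hξ] simpleFamily hξ χ ρ t)) := by
  have hχ := DK.hasCharValues_character hξ hs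
  have hρ (p : Lam) := DK.hasMatrixValues_matrixRep hξ hs p.1.1 p.1.2
  have hZ : Nat.card (ZMod 4) = 4 := Nat.card_zmod 4
  refine ⟨DK.finrank_eq, DK.character hξ hs, fun p => DK.matrixRep hξ hs p.1.1 p.1.2,
    fun _ _ => DK.hasCharValues_iff hξ hs, fun _ _ => DK.hasMatrixValues_iff hξ hs,
    fun _ => Module.finrank_self 𝕜, fun _ => Module.finrank_fin_fun 𝕜 (n := 2),
    hZ, natCard_lam, by rw [Nat.card_sum, hZ, natCard_lam],
    DK.isSimpleModule_simpleFamily hs hρ, ?_, ?_⟩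
  · rintro t t' ⟨e⟩
    exact DK.eq_of_linearEquiv_simpleFamily hs hχ hρ e
  · intro M _ _ _
    exact DK.exists_linearEquiv_simpleFamily hs hχ hρ M

theorem mainTheorem3 {𝕜 : Type u} [Field 𝕜] [IsAlgClosed 𝕜] [CharZero 𝕜]
    {ξ : 𝕜} (hξ : IsPrimitiveRoot ξ 4) {s : 𝕜} (hs : s ^ 2 = 2) :
    Module.finrank 𝕜 (DK hξ) = 64 ∧
    ∃ (χ : ZMod 4 → (DK hξ →ₐ[𝕜] 𝕜)) (ρ : Lam → (DK hξ →ₐ[𝕜] Matrix (Fin 2) (Fin 2) 𝕜)),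
      -- `χ j` and `ρ p` are the unique algebra maps with the prescribed values on generators
      (∀ j φ, HasCharValues hξ s j φ ↔ φ = χ j) ∧
      (∀ p φ, HasMatrixValues hξ s p.1.1 p.1.2 φ ↔ φ = ρ p) ∧
      -- dimensions
      (∀ j, Module.finrank 𝕜 (CharModule (χ j)) = 1) ∧
      (∀ p, Module.finrank 𝕜 (MatModule (ρ p)) = 2) ∧
      -- there are four plus twelve modules in the list
      Nat.card (ZMod 4) = 4 ∧ Nat.card Lam = 12 ∧ Nat.card (ZMod 4 ⊕ Lam) = 16 ∧
      -- all of them are simple, and they are pairwise non-isomorphic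
      (∀ t, IsSimpleModule (DK hξ) (simpleFamily hξ χ ρ t)) ∧
      (∀ t t', Nonempty (simpleFamily hξ χ ρ t ≃ₗ[DK hξ] simpleFamily hξ χ ρ t') → t = t') ∧
      -- every simple module is isomorphic to one of them
      (∀ (M : Type v) [AddCommGroup M] [Module (DK hξ) M], IsSimpleModule (DK hξ) M →
        ∃ t, Nonempty (M ≃ₗ[DK hξ] simpleFamily hξ χ ρ t)) :=
  mainTheorem3_general hξ hs

end
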